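/- A randomized query algorithm is a randomized adaptive decision tree: at each step it either stops and outputs a real number, asks a YES/NO query to an oracle and continues depending on the answer, or makes a random draw from a discrete distribution (at no cost). It makes at most $q$ queries if it never asks more than $q$ queries, whatever the answers and the draws are. A $(1\pm\varepsilon)$-approximation of $m$ is a real number $\widehat m$ with $|m-\widehat m|\le \varepsilon m$. For a graph $G$ on a vertex set $V$, the Bipartite Independent Set (BIS) oracle takes two disjoint sets $A,B\subseteq V$ and reports whether $G$ has an edge with one endpoint in $A$ and the other in $B$; the Tripartite Independent Set (TIS) oracle takes three pairwise disjoint sets $A,B,C\subseteq V$ and reports whether $G$ has a triangle with one vertex in each of $A,B,C$. For a $3$-uniform hypergraph $\mathcal H$ on $V$ (every hyperedge has exactly $3$ vertices), the Colorful Independent Set (CID) oracle takes three pairwise disjoint sets $A_1,A_2,A_3\subseteq V$ and reports whether $\mathcal H$ has a hyperedge with exactly one vertex in each $A_i$. There are absolute constants $c>0$ and $C>0$ such that for every finite set $V$ of $n\ge 1$ vertices and every real $\varepsilon\in(0,1)$ the following hold. (a) (Edge estimation.) There is a randomized query algorithm that makes at most $C\,\frac{(\log n)^{11}}{\varepsilon^2}$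 BIS queries and that, for every graph $G$ with vertex set $V$, outputs a $(1\pm\varepsilon)$-approximation of the number of edges of $G$ with probability at least $1-1/n^{2c}$. (b) (Hyperedge estimation in $3$-uniform hypergraphs.) There is a randomized query algorithm that makes at most $C\,\frac{(\log n)^{14}}{\varepsilon^2}$ CID queries and that, for every $3$-uniform hypergraph $\mathcal H$ with vertex set $V$, outputs a $(1\pm\varepsilon)$-approximation of the number of hyperedges of $\mathcal H$ with probability at least $1-1/n^{3c}$. In particular (triangle estimation), there is a randomized query algorithm that makes at most $C\,\frac{(\log n)^{14}}{\varepsilon^2}$ TIS queries and that, for every graph $G$ with vertex set $V$, outputs a $(1\pm\varepsilon)$-approximation of the number of triangles of $G$ with probability at least $1-1/n^{3c}$. -/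

import Mathlib

/-- Randomized adaptive query algorithms (randomized decision trees) whose queries are the elements
of `Q`, with Boolean answers, and whose outputs are elements of `α`. At each step such an algorithm
either stops with an output, or asks a query and continues depending on the answer, or draws an
element from a fixed discrete probability distribution and continues depending on the result. -/
inductive QueryAlg (Q : Type*) (α : Type*) where
  /-- Stop and output `a`. -/
  | output (a : α) : QueryAlg Q α
  /-- Ask the oracle the query `q` and continue with `next answer`. -/
  | query (q : Q) (next : Bool → QueryAlg Q α) : QueryAlg Q α
  /-- Draw `i` from the distribution `μ` (independently of all previous draws) and continue with
  `next i`; this costs no query. -/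
  | sample (μ : PMF ℕ) (next : ℕ → QueryAlg Q α) : QueryAlg Q α

namespace QueryAlg

/-- The distribution of the output when every query is answered by the oracle `O`. -/
noncomputable def run {Q α : Type*} (O : Q → Bool) : QueryAlg Q α → PMF α
  | output a => PMF.pure a
  | query q next => run O (next (O q))
  | sample μ next => μ.bind fun i => run O (next i)

/-- `A.QueriesAtMost b`: whatever the answers and the random draws are, `A` asks at most `b`
queries. -/
def QueriesAtMost {Q α : Type*} : QueryAlg Q α → ℕ → Prop
  | output _, _ => True
  | query _ _, 0 => False
  | query _ next, b + 1 => ∀ answer, QueriesAtMost (next answer) b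
  | sample μ next, b => ∀ i ∈ μ.support, QueriesAtMost (next i) b

/-- The probability that `A`, run with the oracle `O`, outputs a `(1 ± ε)`-approximation of `m`,
i.e. a number `x` with `|m - x| ≤ ε * m`. -/
noncomputable def approxProb {Q : Type*} (A : QueryAlg Q ℝ) (O : Q → Bool) (ε m : ℝ) : ℝ :=
  ((A.run O).toOuterMeasure {x | |m - x| ≤ ε * m}).toReal

end QueryAlg

/-- A hypergraph on the whole of `V` (as its vertex set) all of whose hyperedges have exactly `d`
vertices. -/
structure Hypergraph.IsUniformOnUniv {V : Type*} (H : Hypergraph V) (d : ℕ) : Prop where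
  vertexSet_eq : H.vertexSet = Set.univ
  ncard_eq : ∀ e ∈ H.edgeSet, e.ncard = d

/-- The inputs of a query: `d` pairwise disjoint sets of vertices. -/
def DisjointSets (V : Type*) (d : ℕ) : Type _ :=
  {A : Fin d → Set V // Pairwise fun i j => Disjoint (A i) (A j)}

open Classical in
/-- The Colorful Independent Set oracle: is there a hyperedge with exactly one vertex in each of the
given sets? -/
noncomputable def cidOracle {V : Type*} {d : ℕ} (H : Hypergraph V) (A : DisjointSets V d) : Bool :=
  decide (∃ e ∈ H.edgeSet, ∀ i, (e ∩ A.1 i).ncard = 1)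

open Classical in
/-- The Bipartite Independent Set oracle: is there an edge with endpoints in both sets? -/
noncomputable def bisOracle {V : Type*} (G : SimpleGraph V) (A : DisjointSets V 2) : Bool :=
  decide (∃ u ∈ A.1 0, ∃ v ∈ A.1 1, G.Adj u v)

open Classical in
/-- The Tripartite Independent Set oracle: is there a triangle with a vertex in each of the three
sets? -/
noncomputable def tisOracle {V : Type*} (G : SimpleGraph V) (A : DisjointSets V 3) : Bool :=
  decide (∃ u ∈ A.1 0, ∃ v ∈ A.1 1, ∃ w ∈ A.1 2, G.Adj u v ∧ G.Adj v w ∧ G.Adj u w)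

/-!
# Approximate counting of edges, hyperedges and triangles with independent set oracles

All three problems ask for the number `N` of injective tuples `v : Fin d → V` that satisfy a
relation `R`, up to the factor `d !` that counts the enumerations of a set, and in all three the
oracle tells whether such a tuple lies in a product of `d` disjoint sets (`IsTupleOracle`). Put
`D = ⌈log₂ n⌉`. The estimator `tupleEstimator` combines two parts.

*Coarse estimates.* For each product `A` of `d` sets, a random colouring of the vertices makes the
sets disjoint, and the `i`-th set is then sampled at rate `2 ^ (-a i)`. If a sampled product still
contains a tuple with constant probability, then `2 ^ ∑ a i` is at most a constant times the number
of tuples in `A`, by Markov's inequality. Conversely, there are rates for which this happens and for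
which `2 ^ ∑ a i` is smaller than the number of tuples at most by the factor `hitLoss D d`, which is
polylogarithmic (`exists_le_unifProb_hits`). Trying all rates yields the number of tuples in `A` up
to a polylogarithmic factor `b` (`toOuterMeasure_coarse_le`). The random choices are made once and
used for all products `A` that occur, so that a union bound makes all the estimates correct
simultaneously, and then they are a deterministic function of `A`.

*Particles.* Halving the sides of the product `V × ⋯ × V` one bit at a time gives a binary tree of
depth `T = d * D`, whose leaves contain at most one tuple and are decided by one query. Going down
this tree, the estimator `particle` keeps `L` weighted nodes: the children of the current nodes are
resampled independently, with probability proportional to weight times coarse estimate, and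
reweighted so that the expected total stays `N`. A level multiplies the second moment of the total
by at most `1 + b / L` (`mean_run_particle`), so that for `L` of order `b * T / ε ^ 2` Chebyshev's
inequality gives a `(1 ± ε)`-approximation with constant probability. The median of `2 * D`
independent runs fails with probability at most `4 ^ (-D)`.

With `b` of order `D ^ (d.choose 2)` and coarse estimates that take on the order of `D ^ (d + 1)`
queries, the number of queries is of order `D ^ (d.choose 2 + d + 4) / ε ^ 2`. The exponent is `7`
for `d = 2` and `10` for `d = 3`.
-/

open scoped ENNReal NNReal

/-! ### Expectations and independent draws -/

namespace PMF

variable {α β : Type*}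

/-- The expectation of a nonnegative function of a random element with distribution `μ`. -/
noncomputable def mean (μ : PMF α) (f : α → ℝ≥0∞) : ℝ≥0∞ := ∑' a, μ a * f a

theorem mean_pure (a : α) (f : α → ℝ≥0∞) : (PMF.pure a).mean f = f a := by
  rw [mean, tsum_eq_single a]
  · simp
  · intro b hb; simp [PMF.pure_apply, hb]

theorem mean_bind (μ : PMF α) (κ : α → PMF β) (f : β → ℝ≥0∞) :
    (μ.bind κ).mean f = μ.mean fun a => (κ a).mean f := by
  simp only [mean, PMF.bind_apply, ← ENNReal.tsum_mul_right, ← ENNReal.tsum_mul_left]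
  rw [ENNReal.tsum_comm]
  simp only [mul_assoc]

theorem mean_map (μ : PMF α) (g : α → β) (f : β → ℝ≥0∞) :
    (μ.map g).mean f = μ.mean fun a => f (g a) := by
  rw [← PMF.bind_pure_comp, mean_bind]
  simp [mean_pure]

theorem mean_mono (μ : PMF α) {f g : α → ℝ≥0∞} (h : ∀ a, f a ≤ g a) : μ.mean f ≤ μ.mean g :=
  ENNReal.tsum_le_tsum fun a => mul_le_mul_right (h a) _

theorem mean_add (μ : PMF α) (f g : α → ℝ≥0∞) :
    (μ.mean fun a => f a + g a) = μ.mean f + μ.mean g := by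
  simp only [mean, mul_add, ENNReal.tsum_add]

theorem mean_const_mul (μ : PMF α) (c : ℝ≥0∞) (f : α → ℝ≥0∞) :
    (μ.mean fun a => c * f a) = c * μ.mean f := by
  simp only [mean, ← ENNReal.tsum_mul_left]
  exact tsum_congr fun a => by ring

theorem mean_const (μ : PMF α) (c : ℝ≥0∞) : (μ.mean fun _ => c) = c := by
  simp [mean, ENNReal.tsum_mul_right]

theorem mean_indicator (μ : PMF α) (s : Set α) :
    μ.mean (s.indicator 1) = μ.toOuterMeasure s := by
  rw [mean, toOuterMeasure_apply]
  refine tsum_congr fun a => ?_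
  by_cases h : a ∈ s <;> simp [h]

theorem toOuterMeasure_bind_eq_mean (μ : PMF α) (κ : α → PMF β) (s : Set β) :
    (μ.bind κ).toOuterMeasure s = μ.mean fun a => (κ a).toOuterMeasure s := by
  simp only [← mean_indicator, mean_bind]

theorem toOuterMeasure_le_one (μ : PMF α) (s : Set α) : μ.toOuterMeasure s ≤ 1 := by
  rw [← mean_indicator, ← mean_const μ 1]
  exact mean_mono μ fun a => Set.indicator_le_self' (by simp) a

theorem toOuterMeasure_add_compl (μ : PMF α) (s : Set α) :
    μ.toOuterMeasure s + μ.toOuterMeasure sᶜ = 1 := by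
  rw [← mean_indicator, ← mean_indicator, ← mean_add, ← mean_const μ 1]
  congr 1; ext a
  by_cases h : a ∈ s <;> simp [h]

/-- Markov's inequality. -/
theorem mul_toOuterMeasure_le_mean (μ : PMF α) (s : Set α) (c : ℝ≥0∞) (f : α → ℝ≥0∞)
    (h : ∀ a ∈ s, c ≤ f a) : c * μ.toOuterMeasure s ≤ μ.mean f := by
  rw [← mean_indicator, ← mean_const_mul]
  refine mean_mono μ fun a => ?_
  by_cases ha : a ∈ s <;> simp [ha, h]

/-- The law of total probability, with an exceptional set of small probability. -/
theorem toOuterMeasure_bind_le (μ : PMF α) (κ : α → PMF β) (s : Set β) (bad : Set α)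
    (δ : ℝ≥0∞) (h : ∀ a ∉ bad, (κ a).toOuterMeasure s ≤ δ) :
    (μ.bind κ).toOuterMeasure s ≤ μ.toOuterMeasure bad + δ := by
  rw [toOuterMeasure_bind_eq_mean, ← mean_indicator, ← mean_const μ δ, ← mean_add]
  refine mean_mono μ fun a => ?_
  by_cases ha : a ∈ bad
  · simp only [ha, Set.indicator_of_mem, Pi.one_apply]
    exact (toOuterMeasure_le_one _ _).trans le_self_add
  · simpa [ha] using h a ha

/-- The distribution of a list of `r` independent draws from `μ`. -/
noncomputable def iid (μ : PMF α) : ℕ → PMF (List α)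
  | 0 => PMF.pure []
  | r + 1 => μ.bind fun a => (iid μ r).map (a :: ·)

theorem mean_iid_succ (μ : PMF α) (r : ℕ) (f : List α → ℝ≥0∞) :
    (μ.iid (r + 1)).mean f = μ.mean fun a => (μ.iid r).mean fun l => f (a :: l) := by
  simp only [iid, mean_bind, mean_map]

theorem length_of_mem_support_iid (μ : PMF α) (r : ℕ) :
    ∀ l ∈ (μ.iid r).support, l.length = r := by
  induction r with
  | zero => simp [iid]
  | succ r ih =>
    intro l hl
    simp only [iid, PMF.mem_support_bind_iff, PMF.mem_support_map_iff] at hl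
    obtain ⟨a, -, l', hl', rfl⟩ := hl
    simp [ih l' hl']

theorem mean_iid_prod (μ : PMF α) (r : ℕ) (f : α → ℝ≥0∞) :
    ((μ.iid r).mean fun l => (l.map f).prod) = μ.mean f ^ r := by
  induction r with
  | zero => simp [iid, mean_pure]
  | succ r ih =>
    simp only [mean_iid_succ, List.map_cons, List.prod_cons, mean_const_mul, ih]
    simp only [mul_comm (f _), mean_const_mul, pow_succ]

theorem mean_iid_sum (μ : PMF α) (r : ℕ) (f : α → ℝ≥0∞) :
    ((μ.iid r).mean fun l => (l.map f).sum) = r * μ.mean f := by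
  induction r with
  | zero => simp [iid, mean_pure]
  | succ r ih =>
    simp only [mean_iid_succ, List.map_cons, List.sum_cons, mean_add, ih, mean_const]
    push_cast; ring

/-- The second moment of a sum of independent copies; `t` is a deterministic offset, which makes
the induction work. -/
theorem mean_iid_sum_sq_le (μ : PMF α) (r : ℕ) (f : α → ℝ≥0∞) (t : ℝ≥0∞) :
    ((μ.iid r).mean fun l => (t + (l.map f).sum) ^ 2) ≤
      (t + r * μ.mean f) ^ 2 + r * μ.mean fun a => f a ^ 2 := by
  induction r generalizing t with
  | zero => simp [iid, mean_pure]
  | succ r ih =>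
    simp only [mean_iid_succ, List.map_cons, List.sum_cons]
    calc (μ.mean fun a => (μ.iid r).mean fun l => (t + (f a + (l.map f).sum)) ^ 2)
        ≤ μ.mean fun a => ((t + r * μ.mean f) ^ 2 + r * μ.mean fun a => f a ^ 2)
            + (2 * (t + r * μ.mean f) * f a + f a ^ 2) := by
          refine mean_mono μ fun a => ?_
          simp only [← add_assoc t]
          refine (ih (t + f a)).trans (le_of_eq ?_)
          ring
      _ = ((t + r * μ.mean f) ^ 2 + r * μ.mean fun a => f a ^ 2)
            + (2 * (t + r * μ.mean f) * μ.mean f + μ.mean fun a => f a ^ 2) := by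
          rw [mean_add, mean_const, mean_add, mean_const_mul]
      _ ≤ ((t + r * μ.mean f) ^ 2 + r * μ.mean fun a => f a ^ 2)
            + (2 * (t + r * μ.mean f) * μ.mean f + μ.mean fun a => f a ^ 2) + μ.mean f ^ 2 :=
          le_self_add
      _ = _ := by push_cast; ring

open Classical in
/-- If each of `r` independent trials is bad with probability at most `1 / 16`, then at least half
of them are bad with probability at most `2⁻ʳ`. This is Markov's inequality for `16 ^ k`, where `k`
is the number of bad trials: its expectation is at most `2 ^ r`. -/
theorem toOuterMeasure_iid_majority_le (μ : PMF α) (bad : Set α)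
    (h : μ.toOuterMeasure bad ≤ 16⁻¹) (r : ℕ) :
    (μ.iid r).toOuterMeasure {l | r ≤ 2 * l.countP (· ∈ bad)} ≤ 2⁻¹ ^ r := by
  have hprod : ∀ l : List α,
      (l.map fun a => if a ∈ bad then (16 : ℝ≥0∞) else 1).prod = 16 ^ l.countP (· ∈ bad) := by
    intro l
    induction l with
    | nil => simp
    | cons a l ih =>
      by_cases ha : a ∈ bad <;> simp [ha, ih, pow_succ, mul_comm]
  have hmean : (μ.mean fun a => if a ∈ bad then (16 : ℝ≥0∞) else 1) ≤ 2 := by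
    calc (μ.mean fun a => if a ∈ bad then (16 : ℝ≥0∞) else 1)
        ≤ μ.mean fun a => 16 * bad.indicator 1 a + 1 := by
          refine mean_mono μ fun a => ?_
          by_cases ha : a ∈ bad <;> simp [ha]
      _ ≤ 16 * 16⁻¹ + 1 := by
          rw [mean_add, mean_const_mul, mean_const, mean_indicator]
          gcongr
      _ = 2 := by
          rw [ENNReal.mul_inv_cancel (by simp) (by simp)]; norm_num
  have key := mul_toOuterMeasure_le_mean (μ.iid r)
    {l | r ≤ 2 * l.countP (· ∈ bad)} (4 ^ r)
    (fun l => (l.map fun a => if a ∈ bad then (16 : ℝ≥0∞) else 1).prod) (by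
      intro l hl
      rw [hprod]
      calc (4 : ℝ≥0∞) ^ r ≤ 4 ^ (2 * l.countP (· ∈ bad)) := pow_le_pow_right₀ (by norm_num) hl
        _ = 16 ^ l.countP (· ∈ bad) := by rw [pow_mul]; norm_num)
  rw [mean_iid_prod] at key
  have h2 : (4 : ℝ≥0∞) ^ r * (μ.iid r).toOuterMeasure
      {l | r ≤ 2 * l.countP (· ∈ bad)} ≤ 2 ^ r :=
    key.trans (pow_le_pow_left₀ (by simp) hmean r)
  have h4 : (4 : ℝ≥0∞) ^ r = 2 ^ r * 2 ^ r := by rw [← mul_pow]; norm_num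
  rw [h4, mul_assoc] at h2
  have h5 : (2 : ℝ≥0∞) ^ r * (μ.iid r).toOuterMeasure
      {l | r ≤ 2 * l.countP (· ∈ bad)} ≤ 1 := by
    have := (ENNReal.mul_le_mul_iff_right (a := (2 : ℝ≥0∞) ^ r) (by simp) (by simp)).1
      (h2.trans_eq (mul_one _).symm)
    exact this
  rw [← ENNReal.inv_pow, ENNReal.le_inv_iff_mul_le, mul_comm]
  exact h5

/-- Among `r` independent trials none is in `s` with probability `(1 - μ s) ^ r`. -/
theorem toOuterMeasure_iid_forall_notMem (μ : PMF α) (s : Set α) (r : ℕ) :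
    (μ.iid r).toOuterMeasure {l | ∀ a ∈ l, a ∉ s} = μ.toOuterMeasure sᶜ ^ r := by
  rw [← mean_indicator, ← mean_indicator, ← mean_iid_prod]
  congr 1; ext l
  induction l with
  | nil => simp
  | cons a l ih =>
    rw [List.map_cons, List.prod_cons, ← ih]
    by_cases ha : a ∈ s
    · simp [ha]
    · have hiff : (a :: l ∈ {l | ∀ a ∈ l, a ∉ s}) ↔ l ∈ {l | ∀ a ∈ l, a ∉ s} :=
        List.forall_mem_cons.trans (and_iff_right ha)
      by_cases hl : l ∈ {l | ∀ a ∈ l, a ∉ s}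
      · rw [Set.indicator_of_mem (hiff.2 hl), Set.indicator_of_mem hl]; simp [ha]
      · rw [Set.indicator_of_notMem (mt hiff.1 hl), Set.indicator_of_notMem hl]; simp

theorem toOuterMeasure_iid_exists_mem_le (μ : PMF α) (s : Set α) (r : ℕ) :
    (μ.iid r).toOuterMeasure {l | ∃ a ∈ l, a ∈ s} ≤ r * μ.toOuterMeasure s := by
  rw [← mean_indicator, ← mean_indicator, ← mean_iid_sum]
  refine mean_mono _ fun l => ?_
  by_cases hl : ∃ a ∈ l, a ∈ s
  · obtain ⟨a, hal, has⟩ := hl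
    calc _ ≤ (1 : ℝ≥0∞) := Set.indicator_le_self' (by simp) l
      _ = s.indicator 1 a := by simp [has]
      _ ≤ _ := List.single_le_sum (by simp) _ (List.mem_map_of_mem hal)
  · simp [Set.indicator, hl]

end PMF

/-! ### Composing query algorithms -/

namespace QueryAlg

variable {Q α β : Type*}

theorem QueriesAtMost.mono {A : QueryAlg Q α} {a b : ℕ} (h : A.QueriesAtMost a) (hab : a ≤ b) :
    A.QueriesAtMost b := by
  induction A generalizing a b with
  | output x => simp [QueriesAtMost]
  | query q next ih =>
    match a, b, h, hab with
    | a + 1, b + 1, h, hab =>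
      simp only [QueriesAtMost] at h ⊢
      exact fun ans => ih ans (h ans) (by omega)
  | sample μ next ih =>
    simp only [QueriesAtMost] at h ⊢
    exact fun i hi => ih i (h i hi) hab

/-- Run `A` and pass its output to `k`. -/
def bind : QueryAlg Q α → (α → QueryAlg Q β) → QueryAlg Q β
  | output a, k => k a
  | query q next, k => query q fun ans => bind (next ans) k
  | sample μ next, k => sample μ fun i => bind (next i) k

theorem run_bind (O : Q → Bool) (A : QueryAlg Q α) (k : α → QueryAlg Q β) :
    (A.bind k).run O = (A.run O).bind fun a => (k a).run O := by
  induction A with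
  | output a => simp [bind, run]
  | query q next ih => simp [bind, run, ih]
  | sample μ next ih => simp [bind, run, ih, PMF.bind_bind]

/-- `A.Outputs p`: every output that `A` can produce satisfies `p`, whatever the answers are. -/
def Outputs (p : α → Prop) : QueryAlg Q α → Prop
  | output a => p a
  | query _ next => ∀ ans, Outputs p (next ans)
  | sample μ next => ∀ i ∈ μ.support, Outputs p (next i)

theorem outputs_true (A : QueryAlg Q α) : A.Outputs fun _ => True := by
  induction A <;> simp_all [Outputs]

theorem Outputs.bind {p : α → Prop} {p' : β → Prop} {A : QueryAlg Q α} (hA : A.Outputs p)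
    {k : α → QueryAlg Q β} (hk : ∀ x, p x → (k x).Outputs p') : (A.bind k).Outputs p' := by
  induction A with
  | output x => exact hk x hA
  | query q next ih => exact fun ans => ih ans (hA ans)
  | sample μ next ih => exact fun i hi => ih i (hA i hi)

theorem QueriesAtMost.bind_of_outputs {p : α → Prop} {A : QueryAlg Q α} {a b : ℕ}
    (hA : A.QueriesAtMost a) (hp : A.Outputs p) {k : α → QueryAlg Q β}
    (hk : ∀ x, p x → (k x).QueriesAtMost b) : (A.bind k).QueriesAtMost (a + b) := by
  induction A generalizing a with
  | output x => exact (hk x hp).mono (by omega)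
  | query q next ih =>
    match a, hA with
    | a + 1, hA =>
      rw [show a + 1 + b = (a + b) + 1 by omega]
      exact fun ans => ih ans (hA ans) (hp ans)
  | sample μ next ih =>
    simp only [QueriesAtMost, QueryAlg.bind] at hA ⊢
    exact fun i hi => ih i (hA i hi) (hp i hi)

theorem QueriesAtMost.bind {A : QueryAlg Q α} {a b : ℕ} (hA : A.QueriesAtMost a)
    {k : α → QueryAlg Q β} (hk : ∀ x, (k x).QueriesAtMost b) :
    (A.bind k).QueriesAtMost (a + b) :=
  hA.bind_of_outputs (outputs_true A) fun x _ => hk x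

/-- Draw from a distribution on a countable type, by drawing the code of an element. -/
noncomputable def draw [Countable β] [Nonempty β] (μ : PMF β) : QueryAlg Q β :=
  let e := (exists_injective_nat β).choose
  sample (μ.map e) fun i => output (Function.invFun e i)

theorem run_draw [Countable β] [Nonempty β] (μ : PMF β) (O : Q → Bool) :
    (draw μ : QueryAlg Q β).run O = μ := by
  have he : Function.LeftInverse _ _ :=
    Function.leftInverse_invFun (exists_injective_nat β).choose_spec
  simp only [draw, run, PMF.bind_map]
  convert PMF.bind_pure μ using 2
  funext b
  simp [he b]

theorem queriesAtMost_draw [Countable β] [Nonempty β] (μ : PMF β) :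
    (draw μ : QueryAlg Q β).QueriesAtMost 0 := by
  simp [draw, QueriesAtMost]

theorem outputs_draw [Countable β] [Nonempty β] (μ : PMF β) :
    (draw μ : QueryAlg Q β).Outputs (· ∈ μ.support) := by
  have he : Function.LeftInverse _ _ :=
    Function.leftInverse_invFun (exists_injective_nat β).choose_spec
  intro i hi
  obtain ⟨b, hb, rfl⟩ := (PMF.mem_support_map_iff _ _ _).1 hi
  change Function.invFun _ _ ∈ _
  rwa [he b]

/-- The answers of the oracle `O` to the queries in `qs`; all other queries are answered `false`. -/
noncomputable def restrictOracle (O : Q → Bool) (qs : List Q) : Q → Bool :=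
  open Classical in fun q => if q ∈ qs then O q else false

/-- Ask all the queries in `qs` and output the table of the answers. -/
noncomputable def learn : List Q → QueryAlg Q (Q → Bool)
  | [] => output fun _ => false
  | q :: qs => query q fun ans => (learn qs).bind fun f =>
      output (open Classical in Function.update f q ans)

theorem run_learn (O : Q → Bool) (qs : List Q) :
    (learn qs).run O = PMF.pure (restrictOracle O qs) := by
  induction qs with
  | nil => simp only [learn, run]; congr 1
  | cons q qs ih =>
    simp only [learn, run, run_bind, ih, PMF.pure_bind]
    congr 1; funext q'
    by_cases h : q' = q
    · subst h; simp [restrictOracle]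
    · by_cases h' : q' ∈ qs <;> simp [restrictOracle, h, h']

theorem queriesAtMost_learn (qs : List Q) : (learn qs).QueriesAtMost qs.length := by
  induction qs with
  | nil => simp [learn, QueriesAtMost]
  | cons q qs ih => exact fun ans => ih.bind (b := 0) fun f => by simp [QueriesAtMost]

/-- Run `A` independently `r` times and output the list of its outputs. -/
def replicate (A : QueryAlg Q α) : ℕ → QueryAlg Q (List α)
  | 0 => output []
  | r + 1 => A.bind fun a => (replicate A r).bind fun l => output (a :: l)

theorem run_replicate (O : Q → Bool) (A : QueryAlg Q α) (r : ℕ) :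
    (A.replicate r).run O = (A.run O).iid r := by
  induction r with
  | zero => rfl
  | succ r ih => simp only [replicate, run_bind, ih, run, PMF.iid]; rfl

theorem queriesAtMost_replicate {A : QueryAlg Q α} {a : ℕ} (hA : A.QueriesAtMost a) (r : ℕ) :
    (A.replicate r).QueriesAtMost (r * a) := by
  induction r with
  | zero => simp [replicate, QueriesAtMost]
  | succ r ih =>
    rw [show (r + 1) * a = a + (r * a + 0) by ring]
    exact hA.bind fun x => ih.bind fun l => by simp [QueriesAtMost]

end QueryAlg

/-! ### Medians -/

open Classical in
/-- Every nonempty list of reals has a median. -/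
theorem List.exists_median (l : List ℝ) (hl : l ≠ []) : ∃ x,
    l.length ≤ 2 * l.countP (fun y => y ≤ x) ∧ l.length ≤ 2 * l.countP (fun y => x ≤ y) := by
  -- the least element that is at least as large as half of the list
  set s := l.toFinset.filter fun x => l.length ≤ 2 * l.countP (fun y => y ≤ x) with hs
  have hlf : l.toFinset.Nonempty := by simpa using hl
  have hne : s.Nonempty := by
    refine ⟨l.toFinset.max' hlf, ?_⟩
    simp only [hs, Finset.mem_filter]
    refine ⟨Finset.max'_mem _ _, ?_⟩
    have : l.countP (fun y => y ≤ l.toFinset.max' hlf) = l.length := by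
      rw [List.countP_eq_length]
      intro y hy
      simpa using Finset.le_max' _ y (by simpa using hy)
    omega
  set x := s.min' hne with hx
  have hxs := s.min'_mem hne
  refine ⟨x, (Finset.mem_filter.1 hxs).2, ?_⟩
  have hsplit : l.length = l.countP (fun y => x ≤ y) + l.countP (fun y => y < x) := by
    rw [List.length_eq_countP_add_countP (fun y => decide (x ≤ y))]
    congr 2; funext y; simp
  by_contra! hlt
  set t := l.toFinset.filter (· < x) with ht
  have htne : t.Nonempty := by
    by_contra h0
    have : l.countP (fun y => y < x) = 0 := by
      rw [List.countP_eq_zero]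
      intro y hy hyx
      exact h0 ⟨y, by simpa [ht, hy] using hyx⟩
    omega
  have hyt := Finset.mem_filter.1 (t.max'_mem htne)
  have hcount : l.countP (fun y => y < x) ≤ l.countP (fun y => y ≤ t.max' htne) := by
    refine List.countP_mono_left fun y hy hyx => ?_
    simp only [decide_eq_true_eq] at hyx ⊢
    exact Finset.le_max' _ y (Finset.mem_filter.2 ⟨by simpa using hy, hyx⟩)
  have : t.max' htne ∈ s := Finset.mem_filter.2 ⟨hyt.1, by omega⟩
  exact absurd (s.min'_le _ this) (not_le.2 hyt.2)

open Classical in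
/-- A median of a list of reals (`0` for the empty list). -/
noncomputable def List.median (l : List ℝ) : ℝ :=
  if hl : l ≠ [] then (l.exists_median hl).choose else 0

open Classical in
/-- If the median lies outside an interval then so does at least half of the list. -/
theorem List.length_le_of_median_notMem (l : List ℝ) (s : Set ℝ) (hs : s.OrdConnected)
    (h : l.median ∉ s) : l.length ≤ 2 * l.countP (· ∈ sᶜ) := by
  by_cases hl : l ≠ []
  · rw [median, dif_pos hl] at h
    obtain ⟨h1, h2⟩ := (l.exists_median hl).choose_spec
    set x := (l.exists_median hl).choose
    -- an interval that misses `x` lies on one side of `x`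
    by_cases hcase : ∃ y ∈ s, y ≤ x
    · obtain ⟨y, hys, hyx⟩ := hcase
      refine h2.trans (Nat.mul_le_mul_left 2 (List.countP_mono_left fun z _ hz => ?_))
      simp only [decide_eq_true_eq] at hz ⊢
      exact fun hzs => h (hs.out hys hzs ⟨hyx, hz⟩)
    · refine h1.trans (Nat.mul_le_mul_left 2 (List.countP_mono_left fun z _ hz => ?_))
      simp only [decide_eq_true_eq] at hz ⊢
      exact fun hzs => hcase ⟨z, hzs, hz⟩
  · simp only [not_not] at hl
    simp [hl]

/-! ### The particle estimator -/

namespace QueryAlg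

variable {Q : Type*}

/-- The total of `f` over a weighted population of nodes of the binary tree; nodes are
represented by the list of the turns that lead to them, the last turn first. -/
noncomputable def total (f : List Bool → ℝ≥0) (P : List (ℝ≥0 × List Bool)) : ℝ≥0 :=
  (P.map fun x => x.1 * f x.2).sum

/-- Replace each node by its two children, with the same weight. -/
def children (P : List (ℝ≥0 × List Bool)) : List (ℝ≥0 × List Bool) :=
  P.flatMap fun x => [(x.1, true :: x.2), (x.1, false :: x.2)]

theorem length_children (P : List (ℝ≥0 × List Bool)) : (children P).length = 2 * P.length := by
  induction P with
  | nil => rfl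
  | cons x P ih =>
    simp only [children, List.flatMap_cons, List.length_append, List.length_cons,
      List.length_nil] at ih ⊢
    omega

theorem total_children {N : List Bool → ℝ≥0} (hN : ∀ s, N s = N (true :: s) + N (false :: s))
    (P : List (ℝ≥0 × List Bool)) : total N (children P) = total N P := by
  induction P with
  | nil => rfl
  | cons x P ih =>
    simp only [total, children, List.flatMap_cons, List.map_append, List.sum_append] at ih ⊢
    rw [ih, List.map_cons (a := x), List.sum_cons (a := x.1 * N x.2), hN x.2]
    simp [mul_add]

theorem total_eq_sum (f : List Bool → ℝ≥0) (P : List (ℝ≥0 × List Bool)) :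
    total f P = ∑ i : Fin P.length, P[i].1 * f P[i].2 := by
  rw [total, ← List.sum_ofFn]
  congr 1
  apply List.ext_getElem <;> simp

/-- The index of a random node of the population `P`, drawn with probability proportional to its
weight times its estimate `e`. -/
noncomputable def resampleIndex (e : List Bool → ℝ≥0) (P : List (ℝ≥0 × List Bool))
    (h : total e P ≠ 0) : PMF (Fin P.length) :=
  PMF.normalize (fun i => ((P[i].1 * e P[i].2 : ℝ≥0) : ℝ≥0∞))
    (by
      rw [tsum_fintype, ← ENNReal.ofNNReal_finsetSum, ← total_eq_sum]
      exact_mod_cast h)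
    (by rw [tsum_fintype, ← ENNReal.ofNNReal_finsetSum]; exact ENNReal.coe_ne_top)

/-- The new weight of a resampled node makes its expected contribution the old one. -/
noncomputable def reweight (e : List Bool → ℝ≥0) (P : List (ℝ≥0 × List Bool)) (L : ℕ)
    (i : Fin P.length) : ℝ≥0 × List Bool :=
  (total e P / (L * e P[i].2), P[i].2)

/-- The mean of `f` over an index drawn by `resampleIndex`. -/
theorem mean_resampleIndex (e : List Bool → ℝ≥0) (P : List (ℝ≥0 × List Bool))
    (h : total e P ≠ 0) (f : Fin P.length → ℝ≥0) :
    ((resampleIndex e P h).mean fun i => (f i : ℝ≥0∞)) =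
      ((∑ i, P[i].1 * e P[i].2 / total e P * f i : ℝ≥0) : ℝ≥0∞) := by
  rw [PMF.mean, tsum_fintype, ENNReal.ofNNReal_finsetSum]
  refine Finset.sum_congr rfl fun i _ => ?_
  rw [resampleIndex, PMF.normalize_apply, tsum_fintype, ← ENNReal.ofNNReal_finsetSum,
    ← total_eq_sum, ← ENNReal.coe_inv h, ← ENNReal.coe_mul, ← ENNReal.coe_mul, div_eq_mul_inv]

theorem mean_resampleIndex_reweight {e N : List Bool → ℝ≥0} {P : List (ℝ≥0 × List Bool)}
    (h : total e P ≠ 0) {L : ℕ} (hL : L ≠ 0) (hNe : ∀ x ∈ P, N x.2 ≤ e x.2) :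
    ((resampleIndex e P h).mean fun i =>
        (((reweight e P L i).1 * N (reweight e P L i).2 : ℝ≥0) : ℝ≥0∞)) =
      ((total N P / L : ℝ≥0) : ℝ≥0∞) := by
  rw [mean_resampleIndex, total_eq_sum N, Finset.sum_div]
  congr 1
  refine Finset.sum_congr rfl fun i _ => ?_
  have hi := hNe P[i] (List.getElem_mem _)
  rcases eq_or_ne (e P[i].2) 0 with h0 | h0
  · have hN0 : N P[i].2 = 0 := le_antisymm (hi.trans_eq h0) zero_le
    simp only [reweight, h0, hN0]; simp
  · have hL' : (L : ℝ≥0) ≠ 0 := by exact_mod_cast hL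
    simp only [reweight]
    field_simp

theorem mean_resampleIndex_reweight_sq_le {e N : List Bool → ℝ≥0} {P : List (ℝ≥0 × List Bool)}
    (h : total e P ≠ 0) {L : ℕ} (hL : L ≠ 0) {b : ℝ≥0} (hNe : ∀ x ∈ P, N x.2 ≤ e x.2)
    (heN : ∀ x ∈ P, e x.2 ≤ b * N x.2) :
    ((resampleIndex e P h).mean fun i =>
        ((((reweight e P L i).1 * N (reweight e P L i).2) ^ 2 : ℝ≥0) : ℝ≥0∞)) ≤
      ((b * total N P ^ 2 / L ^ 2 : ℝ≥0) : ℝ≥0∞) := by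
  have hL' : (L : ℝ≥0) ≠ 0 := by exact_mod_cast hL
  rw [mean_resampleIndex, ENNReal.coe_le_coe]
  have hS : total e P ≤ b * total N P := by
    rw [total_eq_sum, total_eq_sum, Finset.mul_sum]
    refine Finset.sum_le_sum fun i _ => ?_
    rw [mul_left_comm]
    exact mul_le_mul_right (heN P[i] (List.getElem_mem _)) _
  calc _ ≤ ∑ i : Fin P.length, total e P / L ^ 2 * (P[i].1 * N P[i].2) := by
        refine Finset.sum_le_sum fun i _ => ?_
        have hi := hNe P[i] (List.getElem_mem _)
        rcases eq_or_ne (e P[i].2) 0 with h0 | h0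
        · have hN0 : N P[i].2 = 0 := le_antisymm (hi.trans_eq h0) zero_le
          simp only [reweight, h0, hN0]; simp
        · simp only [reweight]
          calc _ = total e P / L ^ 2 * (P[i].1 * N P[i].2) * (N P[i].2 / e P[i].2) := by field_simp
            _ ≤ total e P / L ^ 2 * (P[i].1 * N P[i].2) * 1 := by
              gcongr
              exact div_le_one_of_le₀ hi (by simp)
            _ = _ := mul_one _
    _ = total e P / L ^ 2 * total N P := by rw [← Finset.mul_sum, ← total_eq_sum]
    _ ≤ b * total N P / L ^ 2 * total N P := by gcongr
    _ = _ := by ring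

open Classical in
/-- The particle estimator. `est o s` is the estimate for the node `s` computed from the oracle
answers `o`, and `qs s` are the queries it depends on. The population `P` at depth `T - k` is
replaced by `L` nodes drawn independently with probability proportional to weight times estimate,
and these by their children; at depth `T` the total estimate is output. -/
noncomputable def particle (est : (Q → Bool) → List Bool → ℝ≥0) (qs : List Bool → List Q)
    (L : ℕ) : ℕ → List (ℝ≥0 × List Bool) → QueryAlg Q ℝ≥0
  | 0, P => (learn (P.flatMap fun x => qs x.2)).bind fun o => output (total (est o) P)
  | k + 1, P => (learn (P.flatMap fun x => qs x.2)).bind fun o =>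
      if h : total (est o) P = 0 then output 0 else
        (draw ((resampleIndex (est o) P h).iid L)).bind fun l =>
          particle est qs L k (children (l.map (reweight (est o) P L)))

theorem length_flatMap_le {qs : List Bool → List Q} {q : ℕ} (hq : ∀ s, (qs s).length ≤ q)
    (P : List (ℝ≥0 × List Bool)) : (P.flatMap fun x => qs x.2).length ≤ P.length * q := by
  induction P with
  | nil => simp
  | cons x P ih =>
    have := hq x.2
    simp only [List.flatMap_cons, List.length_append, List.length_cons, add_mul]
    omega

theorem queriesAtMost_particle (est : (Q → Bool) → List Bool → ℝ≥0) (qs : List Bool → List Q)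
    {L q : ℕ} (hq : ∀ s, (qs s).length ≤ q) (k : ℕ) (P : List (ℝ≥0 × List Bool))
    (hP : P.length ≤ 2 * L) : (particle est qs L k P).QueriesAtMost ((k + 1) * (2 * L * q)) := by
  have hlen := (length_flatMap_le hq P).trans (Nat.mul_le_mul_right q hP)
  induction k generalizing P with
  | zero =>
    exact (((queriesAtMost_learn _).mono hlen).bind (b := 0) fun o => by
      simp [QueriesAtMost]).mono (by simp)
  | succ k ih =>
    rw [show (k + 1 + 1) * (2 * L * q) = 2 * L * q + (0 + (k + 1) * (2 * L * q)) by ring]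
    refine ((queriesAtMost_learn _).mono hlen).bind fun o => ?_
    split_ifs with h
    · simp [QueriesAtMost]
    · refine (queriesAtMost_draw _).bind_of_outputs (outputs_draw _) fun l hl => ?_
      have hl' : (children (l.map (reweight (est o) P L))).length ≤ 2 * L := by
        rw [length_children, List.length_map, PMF.length_of_mem_support_iid _ _ _ hl]
      exact ih _ hl' ((length_flatMap_le hq _).trans (Nat.mul_le_mul_right q hl'))

/-- The particle estimator is unbiased, and each level of the tree increases its second moment by a
factor of at most `1 + b / L`, if the estimates are correct up to a factor of `b` and exact at the
leaves. -/
theorem mean_run_particle {N : List Bool → ℝ≥0} (hN : ∀ s, N s = N (true :: s) + N (false :: s))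
    {est : (Q → Bool) → List Bool → ℝ≥0} {qs : List Bool → List Q} {O : Q → Bool} {T : ℕ}
    {b : ℝ≥0} {L : ℕ} (hL : L ≠ 0)
    (hloc : ∀ o s, (∀ q ∈ qs s, o q = O q) → est o s = est O s)
    (hNe : ∀ s, s.length ≤ T → N s ≤ est O s) (heN : ∀ s, s.length ≤ T → est O s ≤ b * N s)
    (hleaf : ∀ s, s.length = T → est O s = N s) (k : ℕ) (hk : k ≤ T)
    (P : List (ℝ≥0 × List Bool)) (hP : ∀ x ∈ P, x.2.length = T - k) :
    (((particle est qs L k P).run O).mean fun x => (x : ℝ≥0∞)) = total N P ∧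
    (((particle est qs L k P).run O).mean fun x => ((x ^ 2 : ℝ≥0) : ℝ≥0∞)) ≤
      (((1 + b / L) ^ k * total N P ^ 2 : ℝ≥0) : ℝ≥0∞) := by
  have hL' : (L : ℝ≥0) ≠ 0 := by exact_mod_cast hL
  have hest : ∀ P : List (ℝ≥0 × List Bool), ∀ x ∈ P,
      est (restrictOracle O (P.flatMap fun x => qs x.2)) x.2 = est O x.2 := by
    intro P x hx
    refine hloc _ _ fun q hq => ?_
    simp only [restrictOracle]
    rw [if_pos]
    exact List.mem_flatMap.2 ⟨x, hx, hq⟩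
  induction k generalizing P with
  | zero =>
    have hS : total (est (restrictOracle O (P.flatMap fun x => qs x.2))) P = total N P := by
      simp only [total]
      congr 1
      refine List.map_congr_left fun x hx => ?_
      rw [hest P x hx, hleaf _ (by simpa using hP x hx)]
    simp [particle, run_bind, run_learn, PMF.pure_bind, run, PMF.mean_pure, hS]
  | succ k ih =>
    simp only [particle, run_bind, run_learn, PMF.pure_bind]
    set e := est (restrictOracle O (P.flatMap fun x => qs x.2)) with he
    have hNe' : ∀ x ∈ P, N x.2 ≤ e x.2 := fun x hx => by
      rw [he, hest P x hx]; exact hNe _ (by have := hP x hx; omega)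
    have heN' : ∀ x ∈ P, e x.2 ≤ b * N x.2 := fun x hx => by
      rw [he, hest P x hx]; exact heN _ (by have := hP x hx; omega)
    split_ifs with h
    · have hle : total N P ≤ total e P := by
        rw [total_eq_sum, total_eq_sum]
        exact Finset.sum_le_sum fun i _ => mul_le_mul_right (hNe' _ (List.getElem_mem _)) _
      have h0 : total N P = 0 := by simpa [h] using hle
      simp [run, PMF.mean_pure, h0]
    · have ihl : ∀ l : List (Fin P.length), _ := fun l =>
        ih (by omega) (children (l.map (reweight e P L))) (by
          intro x hx
          simp only [children, List.mem_flatMap, List.mem_map] at hx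
          obtain ⟨_, ⟨i, -, rfl⟩, hx⟩ := hx
          have hPi := hP P[i] (List.getElem_mem _)
          simp only [reweight, List.mem_cons, List.not_mem_nil, or_false] at hx
          rcases hx with rfl | rfl <;> simp only [List.length_cons] <;> omega)
      simp only [run_bind, run_draw, PMF.mean_bind]
      have htot : ∀ l : List (Fin P.length),
          ((total N (children (l.map (reweight e P L))) : ℝ≥0) : ℝ≥0∞) =
          (l.map fun i => (((reweight e P L i).1 * N (reweight e P L i).2 : ℝ≥0) : ℝ≥0∞)).sum := by
        intro l
        rw [total_children hN, total, List.map_map]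
        induction l with
        | nil => simp
        | cons i l ih =>
          rw [List.map_cons, List.sum_cons, List.map_cons, List.sum_cons, ENNReal.coe_add, ih]
          rfl
      constructor
      · simp only [fun l => (ihl l).1, htot, PMF.mean_iid_sum]
        rw [mean_resampleIndex_reweight h hL hNe', ← ENNReal.coe_natCast, ← ENNReal.coe_mul]
        congr 1
        field_simp
      · calc _ ≤ ((resampleIndex e P h).iid L).mean fun l => (((1 + b / L) ^ k : ℝ≥0) : ℝ≥0∞) *
              (0 + (l.map fun i =>
                (((reweight e P L i).1 * N (reweight e P L i).2 : ℝ≥0) : ℝ≥0∞)).sum) ^ 2 := by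
              refine PMF.mean_mono _ fun l => (ihl l).2.trans (le_of_eq ?_)
              rw [zero_add, ← htot]
              push_cast; rfl
          _ ≤ (((1 + b / L) ^ k : ℝ≥0) : ℝ≥0∞) *
              ((0 + L * ((total N P / L : ℝ≥0) : ℝ≥0∞)) ^ 2 +
                L * ((b * total N P ^ 2 / L ^ 2 : ℝ≥0) : ℝ≥0∞)) := by
              rw [PMF.mean_const_mul]
              gcongr
              refine (PMF.mean_iid_sum_sq_le _ _ _ _).trans ?_
              rw [mean_resampleIndex_reweight h hL hNe']
              gcongr
              exact_mod_cast mean_resampleIndex_reweight_sq_le h hL hNe' heN'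
          _ = _ := by
              rw [zero_add, ← ENNReal.coe_natCast]
              norm_cast
              rw [pow_succ (1 + b / (L : ℝ≥0)) k, mul_assoc ((1 + b / (L : ℝ≥0)) ^ k)]
              congr 1
              push_cast
              field_simp

/-- Chebyshev's inequality, in terms of the second moment. -/
theorem toOuterMeasure_chebyshev (μ : PMF ℝ≥0) (N : ℝ≥0) {ε δ : ℝ} (hε : 0 < ε)
    (h1 : (μ.mean fun x => (x : ℝ≥0∞)) = N)
    (h2 : (μ.mean fun x => ((x ^ 2 : ℝ≥0) : ℝ≥0∞)) ≤ ENNReal.ofReal ((1 + δ * ε ^ 2) * N ^ 2))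
    (hδ : 0 ≤ δ) :
    μ.toOuterMeasure {x | ¬ |(N : ℝ) - x| ≤ ε * N} ≤ ENNReal.ofReal δ := by
  have hid : ∀ x : ℝ≥0, ENNReal.ofReal (((N : ℝ) - x) ^ 2) + 2 * N * (x : ℝ≥0∞) =
      ((x ^ 2 : ℝ≥0) : ℝ≥0∞) + N ^ 2 := by
    intro x
    rw [← ENNReal.ofReal_coe_nnreal, ← ENNReal.ofReal_coe_nnreal (p := x),
      ← ENNReal.ofReal_coe_nnreal (p := x ^ 2), show (2 : ℝ≥0∞) = ENNReal.ofReal 2 by simp,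
      ← ENNReal.ofReal_mul (by norm_num), ← ENNReal.ofReal_mul (by positivity),
      ← ENNReal.ofReal_pow (by positivity), ← ENNReal.ofReal_add (by positivity) (by positivity),
      ← ENNReal.ofReal_add (by positivity) (by positivity)]
    congr 1
    push_cast
    ring
  have hvar : (μ.mean fun x => ENNReal.ofReal (((N : ℝ) - x) ^ 2)) ≤
      ENNReal.ofReal (δ * ε ^ 2 * N ^ 2) := by
    have hsum : (μ.mean fun x => ENNReal.ofReal (((N : ℝ) - x) ^ 2)) + 2 * N * N ≤
        ENNReal.ofReal (δ * ε ^ 2 * N ^ 2) + 2 * N * N := by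
      calc _ = (μ.mean fun x => ENNReal.ofReal (((N : ℝ) - x) ^ 2) + 2 * N * (x : ℝ≥0∞)) := by
            rw [PMF.mean_add, PMF.mean_const_mul, h1]
        _ = (μ.mean fun x => ((x ^ 2 : ℝ≥0) : ℝ≥0∞)) + N ^ 2 := by
            simp only [hid, PMF.mean_add, PMF.mean_const]
        _ ≤ ENNReal.ofReal ((1 + δ * ε ^ 2) * N ^ 2) + N ^ 2 := by gcongr
        _ = _ := by
            rw [← ENNReal.ofReal_coe_nnreal, show (2 : ℝ≥0∞) = ENNReal.ofReal 2 by simp,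
              ← ENNReal.ofReal_mul (by norm_num), ← ENNReal.ofReal_mul (by positivity),
              ← ENNReal.ofReal_pow (by positivity),
              ← ENNReal.ofReal_add (by positivity) (by positivity),
              ← ENNReal.ofReal_add (by positivity) (by positivity)]
            congr 1
            ring
    exact (ENNReal.add_le_add_iff_right (by finiteness)).1 hsum
  rcases eq_or_ne N 0 with rfl | hN
  · -- a random variable of mean zero vanishes almost surely
    have h0 : μ.toOuterMeasure {x | ¬ |((0 : ℝ≥0) : ℝ) - x| ≤ ε * (0 : ℝ≥0)} = 0 := by
      rw [PMF.mean, ENNReal.coe_zero, ENNReal.tsum_eq_zero] at h1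
      rw [PMF.toOuterMeasure_apply_eq_zero_iff, Set.disjoint_left]
      intro x hx hx'
      have := h1 x
      rw [mul_eq_zero, or_iff_right ((PMF.mem_support_iff _ _).1 hx)] at this
      simp only [ENNReal.coe_eq_zero] at this
      simp [this] at hx'
    rw [h0]; simp
  · have hNpos : (0 : ℝ) < N := by exact_mod_cast pos_iff_ne_zero.2 hN
    have hpos : 0 < ε ^ 2 * (N : ℝ) ^ 2 := by positivity
    have key := (PMF.mul_toOuterMeasure_le_mean μ {x : ℝ≥0 | ¬ |(N : ℝ) - x| ≤ ε * N}
      (ENNReal.ofReal (ε ^ 2 * N ^ 2)) (fun x => ENNReal.ofReal (((N : ℝ) - x) ^ 2)) (by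
        intro x hx
        apply ENNReal.ofReal_le_ofReal
        rw [← mul_pow, ← sq_abs ((N : ℝ) - x)]
        have hx' : ε * N < |(N : ℝ) - x| := not_le.1 hx
        gcongr)).trans hvar
    rw [mul_assoc δ, mul_comm δ, ENNReal.ofReal_mul hpos.le] at key
    exact (ENNReal.mul_le_mul_iff_right (by simpa using hpos) ENNReal.ofReal_ne_top).1 key

end QueryAlg

/-! ### Uniform probabilities on finite product spaces -/

section UniformProbability

variable {α β X : Type*} [Fintype α] [Fintype β] [Fintype X]

open Classical in
/-- The probability that a uniformly random element of a finite type satisfies `p`. -/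
noncomputable def unifProb (p : α → Prop) : ℝ :=
  (Finset.univ.filter p).card / Fintype.card α

theorem unifProb_nonneg (p : α → Prop) : 0 ≤ unifProb p := by
  unfold unifProb; positivity

theorem unifProb_true [Nonempty α] : unifProb (fun _ : α => True) = 1 := by
  simp [unifProb]

theorem unifProb_mono {p p' : α → Prop} (h : ∀ x, p x → p' x) : unifProb p ≤ unifProb p' := by
  unfold unifProb
  gcongr with x
  exact h x

theorem unifProb_not [Nonempty α] (p : α → Prop) : unifProb (fun x => ¬ p x) = 1 - unifProb p := by
  classical
  have h := Finset.card_filter_add_card_filter_not (s := (Finset.univ : Finset α)) p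
  have h' : (Fintype.card α : ℝ) ≠ 0 := by simp
  unfold unifProb
  rw [eq_sub_iff_add_eq, ← add_div, div_eq_one_iff_eq h']
  rw [Finset.card_univ] at h
  rw [← h]
  push_cast
  rw [add_comm]
  congr!

theorem unifProb_le_one [Nonempty α] (p : α → Prop) : unifProb p ≤ 1 :=
  (unifProb_mono fun _ _ => trivial).trans_eq unifProb_true

theorem unifProb_exists_le {ι : Type*} (s : Finset ι) (p : ι → α → Prop) :
    unifProb (fun x => ∃ i ∈ s, p i x) ≤ ∑ i ∈ s, unifProb (p i) := by
  classical
  unfold unifProb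
  rw [← Finset.sum_div]
  gcongr
  rw [← Nat.cast_sum, Nat.cast_le]
  refine (Finset.card_le_card (t := s.biUnion fun i => Finset.univ.filter (p i)) ?_).trans
    Finset.card_biUnion_le |>.trans (le_of_eq ?_)
  · intro x; simp
  · congr!

theorem toOuterMeasure_uniformOfFintype [Nonempty α] (p : α → Prop) :
    (PMF.uniformOfFintype α).toOuterMeasure {x | p x} = ENNReal.ofReal (unifProb p) := by
  classical
  rw [PMF.toOuterMeasure_uniformOfFintype_apply, unifProb,
    ENNReal.ofReal_div_of_pos (by exact_mod_cast Fintype.card_pos), ENNReal.ofReal_natCast,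
    ENNReal.ofReal_natCast, Fintype.card_subtype]
  congr!

theorem unifProb_equiv (e : α ≃ β) (p : β → Prop) : unifProb (fun x => p (e x)) = unifProb p := by
  classical
  unfold unifProb
  rw [Fintype.card_congr e]
  congr 2
  refine Finset.card_bij (fun x _ => e x) (by simp) (by simp) fun y hy =>
    ⟨e.symm y, by simpa using hy⟩

/-- A lower bound for the probability of an event in a product, by conditioning on the first
coordinate. -/
theorem mul_le_unifProb_prod [Nonempty β] (p : α × β → Prop) (h : α → Prop) (c : ℝ)
    (hc : ∀ x, h x → c ≤ unifProb fun y => p (x, y)) : unifProb h * c ≤ unifProb p := by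
  classical
  have hβ : (0 : ℝ) < Fintype.card β := by exact_mod_cast Fintype.card_pos
  have hsum : (((Finset.univ.filter p).card : ℕ) : ℝ) =
      ∑ x, ((Finset.univ.filter fun y => p (x, y)).card : ℝ) := by
    simp only [Finset.card_filter, Nat.cast_sum, Fintype.sum_prod_type]
  unfold unifProb at hc ⊢
  rw [Fintype.card_prod, Nat.cast_mul, ← div_div, div_mul_eq_mul_div, div_right_comm]
  gcongr
  rw [le_div_iff₀ hβ]
  calc _ = ∑ x ∈ Finset.univ.filter h, c * Fintype.card β := by
        rw [Finset.sum_const, nsmul_eq_mul, mul_assoc]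
    _ ≤ ∑ x ∈ Finset.univ.filter h, ((Finset.univ.filter fun y => p (x, y)).card : ℝ) := by
        refine Finset.sum_le_sum fun x hx => ?_
        rw [← le_div_iff₀ hβ]
        exact hc x (Finset.mem_filter.1 hx).2
    _ ≤ _ := Finset.sum_le_sum_of_subset_of_nonneg (Finset.filter_subset _ _) (by simp)
    _ = _ := hsum.symm

theorem unifProb_snd [Nonempty α] (p : β → Prop) :
    unifProb (fun x : α × β => p x.2) = unifProb p := by
  classical
  have hα : (Fintype.card α : ℝ) ≠ 0 := by simp
  have h : Finset.univ.filter (fun x : α × β => p x.2) =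
      Finset.univ ×ˢ Finset.univ.filter p := by ext; simp
  unfold unifProb
  rw [h, Fintype.card_prod, Nat.cast_mul, Finset.card_product, Finset.card_univ, Nat.cast_mul,
    mul_div_mul_left _ _ hα]

theorem unifProb_forall {ι : Type*} [Fintype ι] [DecidableEq ι] (p : ι → X → Prop) :
    unifProb (fun x : ι → X => ∀ i, p i (x i)) = ∏ i, unifProb (p i) := by
  classical
  unfold unifProb
  rw [Finset.prod_div_distrib, Finset.prod_const, Fintype.card_fun, Finset.card_univ,
    ← Nat.cast_prod, ← Fintype.card_piFinset, Nat.cast_pow]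
  congr 3
  ext x; simp

theorem unifProb_cons {k : ℕ} (p : (Fin (k + 1) → X) → Prop) :
    unifProb (fun x : X × (Fin k → X) => p (Fin.cons x.1 x.2)) = unifProb p :=
  unifProb_equiv (Fin.consEquiv fun _ => X) p

theorem unifProb_lt {M m : ℕ} (h : m ≤ M) :
    unifProb (fun y : Fin M => (y : ℕ) < m) = (m : ℝ) / M := by
  classical
  unfold unifProb
  rw [Fintype.card_fin]
  congr 2
  rw [← Fintype.card_subtype, Fintype.card_congr (Fin.castLEquiv h).symm]
  simp

theorem one_sub_pow_le {x : ℝ} (h0 : 0 ≤ x) (h1 : x ≤ 1) (k : ℕ) :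
    (1 - x) ^ k ≤ 1 / (1 + k * x) := by
  rw [le_div_iff₀ (by positivity)]
  calc (1 - x) ^ k * (1 + k * x) ≤ (1 - x) ^ k * (1 + x) ^ k := by
        have := one_add_mul_le_pow (a := x) (by linarith) k
        have h2 : (0 : ℝ) ≤ (1 - x) ^ k := pow_nonneg (by linarith) k
        gcongr
    _ = (1 - x ^ 2) ^ k := by rw [← mul_pow]; ring
    _ ≤ 1 := pow_le_one₀ (by nlinarith) (by nlinarith)

end UniformProbability

/-! ### Random subsets that hit a family of tuples -/

section Sampling

variable {V : Type*} [Fintype V] [DecidableEq V] {D : ℕ}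

/-- `x` contains `u` at rate `2⁻ᵃ`: the random label of `u` is among the first
`2 ^ (D - a)` of the `2 ^ D` labels. -/
def Picked (x : V → Fin (2 ^ D)) (a : Fin (D + 1)) (u : V) : Prop := (x u : ℕ) < 2 ^ (D - a)

theorem unifProb_label (a : Fin (D + 1)) :
    unifProb (fun y : Fin (2 ^ D) => (y : ℕ) < 2 ^ (D - a)) = (2 ^ (a : ℕ))⁻¹ := by
  rw [unifProb_lt (Nat.pow_le_pow_right (by norm_num) (by omega))]
  push_cast
  have ha : (a : ℕ) ≤ D := by omega
  rw [← one_div, div_eq_div_iff (by positivity) (by positivity), ← pow_add]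
  simp [ha]

theorem unifProb_picked (a : Fin (D + 1)) (u : V) :
    unifProb (fun x : V → Fin (2 ^ D) => Picked x a u) = (2 ^ (a : ℕ))⁻¹ := by
  classical
  have h : (fun x : V → Fin (2 ^ D) => Picked x a u) =
      fun x => ∀ w, w = u → (x w : ℕ) < 2 ^ (D - a) := by
    funext x; simp [Picked]
  rw [h, unifProb_forall (fun w (y : Fin (2 ^ D)) => w = u → (y : ℕ) < 2 ^ (D - a)),
    Finset.prod_eq_single u]
  · simp [unifProb_label]
  · intro w _ hw; simp [hw, unifProb_true]
  · simp

theorem unifProb_forall_not_picked (a : Fin (D + 1)) (U : Finset V) :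
    unifProb (fun x : V → Fin (2 ^ D) => ∀ u ∈ U, ¬ Picked x a u) =
      (1 - (2 ^ (a : ℕ))⁻¹) ^ U.card := by
  classical
  simp only [Picked]
  rw [unifProb_forall (fun w (y : Fin (2 ^ D)) => w ∈ U → ¬ (y : ℕ) < 2 ^ (D - a)),
    ← Finset.prod_const, ← Finset.prod_subset (Finset.subset_univ U)]
  · refine Finset.prod_congr rfl fun u hu => ?_
    simp only [hu, true_imp_iff]
    rw [unifProb_not, unifProb_label]
  · intro u _ hu; simp [hu, unifProb_true]

/-- The random sets `x i` contain the coordinates of some tuple in `S`. -/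
def Hits {k : ℕ} (S : Set (Fin k → V)) (a : Fin k → Fin (D + 1))
    (x : Fin k → V → Fin (2 ^ D)) : Prop :=
  ∃ v ∈ S, ∀ i, Picked (x i) (a i) (v i)

theorem unifProb_hits_le {k : ℕ} (S : Set (Fin k → V)) (a : Fin k → Fin (D + 1)) :
    unifProb (Hits S a) ≤ S.ncard / 2 ^ (∑ i, (a i : ℕ)) := by
  classical
  have hS := S.toFinite
  have h : Hits S a = fun x => ∃ v ∈ hS.toFinset, ∀ i, Picked (x i) (a i) (v i) := by
    funext x; simp [Hits]
  rw [h]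
  refine (unifProb_exists_le _ _).trans (le_of_eq ?_)
  have h1 : ∀ v : Fin k → V, unifProb (fun x : Fin k → V → Fin (2 ^ D) =>
      ∀ i, Picked (x i) (a i) (v i)) = (2 ^ (∑ i, (a i : ℕ)))⁻¹ := by
    intro v
    rw [unifProb_forall (fun i y => Picked y (a i) (v i))]
    simp only [unifProb_picked, Finset.prod_inv_distrib, Finset.prod_pow_eq_pow_sum]
  simp only [h1, Finset.sum_const, nsmul_eq_mul]
  rw [Set.ncard_eq_toFinset_card S hS, div_eq_mul_inv]

/-- The loss in the lower bound for the best sampling rates. -/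
def hitLoss (D : ℕ) : ℕ → ℕ
  | 0 => 1
  | k + 1 => 2 * (D + 1) ^ k * hitLoss D k

/-- For some choice of the sampling rates, the expected number of sampled tuples is at least
`1 / hitLoss D k` and some tuple is sampled with constant probability. Each first coordinate `u`
has good rates for the remaining ones; those first coordinates that share the most profitable
rates `α` form a set `U`, which is sampled at rate about `1 / |U|`. -/
theorem exists_le_unifProb_hits (hD : Fintype.card V ≤ 2 ^ D) (k : ℕ) (S : Set (Fin k → V))
    (hS : S.Nonempty) : ∃ a : Fin k → Fin (D + 1),
      S.ncard ≤ hitLoss D k * 2 ^ (∑ i, (a i : ℕ)) ∧ (1 / 2) ^ k ≤ unifProb (Hits S a) := by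
  classical
  induction k with
  | zero =>
    refine ⟨Fin.elim0, ?_, ?_⟩
    · simpa [hitLoss] using Set.ncard_le_one_of_subsingleton S
    · obtain ⟨v, hv⟩ := hS
      rw [pow_zero, ← unifProb_true (α := Fin 0 → V → Fin (2 ^ D))]
      exact unifProb_mono fun x _ => ⟨v, hv, fun i => i.elim0⟩
  | succ k ih =>
    -- the tuples that extend `u`
    set F : V → Set (Fin k → V) := fun u => {w | Fin.cons u w ∈ S} with hF
    have hcard : ∀ {m : ℕ} (S : Set (Fin m → V)),
        (Finset.univ.filter (· ∈ S)).card = S.ncard := fun S => by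
      rw [Set.ncard_eq_toFinset_card']; congr 1; ext; simp
    have hSsum : S.ncard = ∑ u, (F u).ncard := by
      rw [← hcard S, Finset.card_filter,
        ← (Fin.consEquiv fun _ => V).sum_comp, Fintype.sum_prod_type]
      refine Finset.sum_congr rfl fun u _ => ?_
      rw [← hcard (F u), Finset.card_filter]
      rfl
    have hα : ∀ u, ∃ a : Fin k → Fin (D + 1), (F u).Nonempty →
        (F u).ncard ≤ hitLoss D k * 2 ^ (∑ i, (a i : ℕ)) ∧
          (1 / 2) ^ k ≤ unifProb (Hits (F u) a) := by
      intro u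
      by_cases h : (F u).Nonempty
      · obtain ⟨a, ha⟩ := ih (F u) h; exact ⟨a, fun _ => ha⟩
      · exact ⟨fun _ => 0, fun h' => absurd h' h⟩
    choose α hα using hα
    obtain ⟨a, -, ha⟩ : ∃ a ∈ (Finset.univ : Finset (Fin k → Fin (D + 1))),
        S.ncard ≤ (D + 1) ^ k * ∑ u with α u = a, (F u).ncard := by
      refine Finset.exists_le_of_sum_le Finset.univ_nonempty ?_
      rw [← Finset.mul_sum, Finset.sum_fiberwise, ← hSsum]
      simp
    set U : Finset V := Finset.univ.filter fun u => α u = a ∧ (F u).Nonempty with hU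
    have hsumU : ∑ u with α u = a, (F u).ncard ≤
        U.card * (hitLoss D k * 2 ^ (∑ i, (a i : ℕ))) := by
      have h1 : ∑ u with α u = a, (F u).ncard = ∑ u ∈ U, (F u).ncard := by
        symm
        refine Finset.sum_subset (fun u hu => ?_) fun u hu hu' => ?_
        · simp only [hU, Finset.mem_filter] at hu ⊢; exact ⟨hu.1, hu.2.1⟩
        · simp only [hU, Finset.mem_filter, Finset.mem_univ, true_and] at hu hu'
          have : ¬ (F u).Nonempty := fun h => hu' ⟨hu, h⟩
          rw [Set.not_nonempty_iff_eq_empty.1 this, Set.ncard_empty]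
      rw [h1, ← smul_eq_mul, ← Finset.sum_const]
      refine Finset.sum_le_sum fun u hu => ?_
      simp only [hU, Finset.mem_filter] at hu
      have := (hα u hu.2.2).1
      rwa [hu.2.1] at this
    have hSpos : 0 < S.ncard := (Set.ncard_pos S.toFinite).2 hS
    have hUpos : U.card ≠ 0 := by
      intro h0
      rw [h0, zero_mul, Nat.le_zero] at hsumU
      rw [hsumU] at ha
      omega
    have hUD : Nat.log 2 U.card ≤ D := by
      calc _ ≤ Nat.log 2 (2 ^ D) := Nat.log_mono_right ((Finset.card_le_univ U).trans hD)
        _ = D := Nat.log_pow (by norm_num) D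
    set a₀ : Fin (D + 1) := ⟨Nat.log 2 U.card, by omega⟩ with ha₀
    refine ⟨Fin.cons a₀ a, ?_, ?_⟩
    · have hUle : U.card ≤ 2 ^ (a₀ : ℕ) * 2 := by
        rw [← pow_succ]
        exact (Nat.lt_pow_succ_log_self (by norm_num) _).le
      calc S.ncard ≤ (D + 1) ^ k * (U.card * (hitLoss D k * 2 ^ (∑ i, (a i : ℕ)))) :=
            ha.trans (Nat.mul_le_mul_left _ hsumU)
        _ ≤ (D + 1) ^ k * ((2 ^ (a₀ : ℕ) * 2) * (hitLoss D k * 2 ^ (∑ i, (a i : ℕ)))) := by gcongr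
        _ = _ := by
          simp only [Fin.sum_univ_succ, Fin.cons_zero, Fin.cons_succ, hitLoss, pow_add]
          ring
    · have hhit : (1 : ℝ) / 2 ≤ unifProb fun x : V → Fin (2 ^ D) => ∃ u ∈ U, Picked x a₀ u := by
        have h1 := unifProb_not fun x : V → Fin (2 ^ D) => ∃ u ∈ U, Picked x a₀ u
        push Not at h1
        rw [unifProb_forall_not_picked] at h1
        have h2 : ((2 : ℝ) ^ (a₀ : ℕ))⁻¹ ≤ 1 := inv_le_one_of_one_le₀ (one_le_pow₀ (by norm_num))
        have h3 := one_sub_pow_le (by positivity) h2 U.card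
        have h4 : (1 : ℝ) ≤ U.card * ((2 : ℝ) ^ (a₀ : ℕ))⁻¹ := by
          rw [← div_eq_mul_inv, one_le_div (by positivity)]
          exact_mod_cast Nat.pow_log_le_self 2 hUpos
        have h5 : 1 / (1 + U.card * ((2 : ℝ) ^ (a₀ : ℕ))⁻¹) ≤ 1 / 2 := by
          apply one_div_le_one_div_of_le <;> linarith
        linarith
      rw [← unifProb_cons, pow_succ']
      refine (mul_le_mul_of_nonneg_right hhit (by positivity)).trans
        (mul_le_unifProb_prod _ _ _ ?_)
      rintro x ⟨u, hu, hxu⟩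
      simp only [hU, Finset.mem_filter] at hu
      have h := (hα u hu.2.2).2
      rw [hu.2.1] at h
      refine h.trans (unifProb_mono ?_)
      rintro y ⟨w, hw, hyw⟩
      refine ⟨Fin.cons u w, hw, fun i => ?_⟩
      refine Fin.cases ?_ (fun j => ?_) i
      · simpa using hxu
      · simpa using hyw j

/-- A random colouring colours the entries of an injective tuple in the prescribed way with constant
probability. -/
theorem le_unifProb_colouring {d : ℕ} [NeZero d] (v : Fin d → V) (hv : Function.Injective v) :
    (1 / d : ℝ) ^ d ≤ unifProb fun χ : V → Fin d => ∀ i, χ (v i) = i := by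
  classical
  have hd : (0 : ℝ) < d := by exact_mod_cast Nat.pos_of_ne_zero (NeZero.ne d)
  have h : (fun χ : V → Fin d => ∀ i, χ (v i) = i) =
      fun χ => ∀ u, ∀ i, v i = u → χ u = i := by
    funext χ; simp only [forall_comm (α := V), forall_eq']
  rw [h, unifProb_forall (fun u y => ∀ i, v i = u → y = i)]
  have himage : ∏ u, (if u ∈ Finset.univ.image v then (1 / d : ℝ) else 1) = (1 / d : ℝ) ^ d := by
    rw [Finset.prod_ite_mem, Finset.univ_inter, Finset.prod_const,
      Finset.card_image_of_injective _ hv, Finset.card_univ, Fintype.card_fin]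
  rw [← himage]
  refine Finset.prod_le_prod (fun u _ => by positivity) fun u _ => ?_
  split_ifs with hu
  · obtain ⟨i, -, rfl⟩ := Finset.mem_image.1 hu
    have : (1 / d : ℝ) = unifProb fun y : Fin d => y = i := by
      unfold unifProb
      rw [Finset.card_eq_one.2 ⟨i, by ext; simp⟩]; simp
    rw [this]
    exact unifProb_mono fun y hy j hj => by rw [hv hj, hy]
  · rw [← unifProb_true (α := Fin d)]
    exact unifProb_mono fun y _ i hi =>
      absurd (Finset.mem_image_of_mem v (Finset.mem_univ i)) (hi ▸ hu)

end Sampling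

/-! ### The coarse estimator -/

section Coarse

variable {V : Type*} {d D : ℕ}

/-- The tuples that satisfy `R` and whose entries lie in the given sets. -/
def tuplesIn (R : (Fin d → V) → Prop) (A : Fin d → Set V) : Set (Fin d → V) :=
  {v | R v ∧ ∀ i, v i ∈ A i}

/-- The randomness of one trial: a colour in `Fin d` for each vertex, which makes the sampled sets
disjoint, and `d` independent random labels for each vertex. -/
abbrev Trial (V : Type*) (d D : ℕ) := (V → Fin d) × (Fin d → V → Fin (2 ^ D))

/-- The sampled sets: the `i`-th one consists of the vertices of `A i` of colour `i` that are
picked at rate `2 ^ (-a i)`. -/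
def trialQuery (t : Trial V d D) (a : Fin d → Fin (D + 1)) (A : Fin d → Set V) :
    DisjointSets V d :=
  ⟨fun i => {u | u ∈ A i ∧ t.1 u = i ∧ Picked (t.2 i) (a i) u}, fun _ _ hij =>
    Set.disjoint_left.2 fun _ hi hj => hij (hi.2.1.symm.trans hj.2.1)⟩

/-- The groups of trials in which some query is answered positively. -/
def positiveGroups (o : DisjointSets V d → Bool) (a : Fin d → Fin (D + 1)) (A : Fin d → Set V) :
    Set (List (Trial V d D)) :=
  {l | ∃ t ∈ l, o (trialQuery t a A) = true}

open Classical in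
/-- At least half of the groups of trials are positive. -/
def Accepts (o : DisjointSets V d → Bool) (seed : List (List (Trial V d D)))
    (a : Fin d → Fin (D + 1)) (A : Fin d → Set V) : Prop :=
  seed.length ≤ 2 * seed.countP (· ∈ positiveGroups o a A)

open Classical in
/-- The coarse estimate of the number of tuples in `A`, from the largest product of inverse sampling
rates at which the sampled sets still contain tuples. -/
noncomputable def coarse (o : DisjointSets V d → Bool) (seed : List (List (Trial V d D)))
    (A : Fin d → Set V) : ℕ :=
  Finset.univ.sup fun a : Fin d → Fin (D + 1) =>
    if Accepts o seed a A then hitLoss D d * 2 ^ (∑ i, (a i : ℕ)) else 0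

/-- The queries on which the coarse estimate depends. -/
noncomputable def coarseQueries (seed : List (List (Trial V d D))) (A : Fin d → Set V) :
    List (DisjointSets V d) :=
  (Finset.univ : Finset (Fin d → Fin (D + 1))).toList.flatMap fun a =>
    seed.flatten.map fun t => trialQuery t a A

theorem length_coarseQueries {seed : List (List (Trial V d D))} {r g : ℕ} (hr : seed.length = r)
    (hg : ∀ l ∈ seed, l.length = g) (A : Fin d → Set V) :
    (coarseQueries seed A).length = (D + 1) ^ d * (r * g) := by
  have h1 : (seed.map fun l => l.length).sum = r * g := by
    rw [List.map_congr_left hg, List.map_const', List.sum_replicate,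
      smul_eq_mul, hr]
  simp [coarseQueries, List.length_flatMap, h1, Function.comp_def]

theorem coarse_congr {o o' : DisjointSets V d → Bool} {seed : List (List (Trial V d D))}
    {A : Fin d → Set V} (h : ∀ q ∈ coarseQueries seed A, o q = o' q) :
    coarse o seed A = coarse o' seed A := by
  classical
  have hacc : ∀ a, Accepts o seed a A ↔ Accepts o' seed a A := by
    intro a
    unfold Accepts
    rw [List.countP_congr (q := (· ∈ positiveGroups o' a A))]
    intro l hl
    rw [decide_eq_true_iff, decide_eq_true_iff]
    refine exists_congr fun t => and_congr_right fun ht => ?_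
    rw [h]
    simp only [coarseQueries, List.mem_flatMap, Finset.mem_toList, List.mem_map]
    exact ⟨a, Finset.mem_univ _, t, List.mem_flatten.2 ⟨l, hl, ht⟩, rfl⟩
  simp only [coarse, hacc]

variable {R : (Fin d → V) → Prop} {O : DisjointSets V d → Bool}

/-- The oracle `O` answers whether some tuple that satisfies `R` has its entries in the
given sets. -/
def IsTupleOracle (R : (Fin d → V) → Prop) (O : DisjointSets V d → Bool) : Prop :=
  ∀ A, O A = true ↔ ∃ v, R v ∧ ∀ i, v i ∈ A.1 i

theorem trialQuery_eq_true_iff (hO : IsTupleOracle R O) (t : Trial V d D)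
    (a : Fin d → Fin (D + 1)) (A : Fin d → Set V) : O (trialQuery t a A) = true ↔
      ∃ v ∈ tuplesIn R A, (∀ i, t.1 (v i) = i) ∧ ∀ i, Picked (t.2 i) (a i) (v i) := by
  rw [hO]
  simp only [trialQuery, tuplesIn]
  constructor
  · rintro ⟨v, hv, h⟩
    exact ⟨v, ⟨hv, fun i => (h i).1⟩, fun i => (h i).2.1, fun i => (h i).2.2⟩
  · rintro ⟨v, ⟨hv, h1⟩, h2, h3⟩
    exact ⟨v, hv, fun i => ⟨h1 i, h2 i, h3 i⟩⟩

variable [Fintype V] [DecidableEq V]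

theorem unifProb_trialQuery_le [NeZero d] (hO : IsTupleOracle R O) (a : Fin d → Fin (D + 1))
    (A : Fin d → Set V) : unifProb (fun t : Trial V d D => O (trialQuery t a A) = true) ≤
      (tuplesIn R A).ncard / 2 ^ (∑ i, (a i : ℕ)) := by
  refine le_trans ?_ (unifProb_hits_le _ a)
  refine le_trans (unifProb_mono fun t ht => ?_)
    (unifProb_snd (α := V → Fin d) (Hits (tuplesIn R A) a)).le
  obtain ⟨v, hv, -, h⟩ := (trialQuery_eq_true_iff hO t a A).1 ht
  exact ⟨v, hv, h⟩

theorem exists_le_unifProb_trialQuery [NeZero d] (hO : IsTupleOracle R O)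
    (hR : ∀ v, R v → Function.Injective v) (hD : Fintype.card V ≤ 2 ^ D) (A : Fin d → Set V)
    (hA : (tuplesIn R A).Nonempty) : ∃ a : Fin d → Fin (D + 1),
      (tuplesIn R A).ncard ≤ hitLoss D d * 2 ^ (∑ i, (a i : ℕ)) ∧
      1 / (2 * d) ^ d ≤ unifProb fun t : Trial V d D => O (trialQuery t a A) = true := by
  obtain ⟨a, ha, hhit⟩ := exists_le_unifProb_hits hD d _ hA
  refine ⟨a, ha, ?_⟩
  rw [← unifProb_equiv (Equiv.prodComm (Fin d → V → Fin (2 ^ D)) (V → Fin d))]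
  calc (1 / (2 * d) ^ d : ℝ) = (1 / 2) ^ d * (1 / d) ^ d := by
        rw [← mul_pow, div_mul_div_comm, one_mul, div_pow, one_pow]
    _ ≤ unifProb (Hits (tuplesIn R A) a) * (1 / d) ^ d := by gcongr
    _ ≤ _ := by
      refine mul_le_unifProb_prod _ _ _ ?_
      rintro x ⟨v, hv, hx⟩
      refine (le_unifProb_colouring v (hR v hv.1)).trans (unifProb_mono fun χ hχ => ?_)
      exact (trialQuery_eq_true_iff hO _ a A).2 ⟨v, hv, hχ, hx⟩

/-- The number of trials in a group. -/
def groupSize (d : ℕ) : ℕ := 16 * (2 * d) ^ d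

/-- The distribution of the random seed: `r` groups of independent trials. -/
noncomputable def seedDist (V : Type*) [Fintype V] [DecidableEq V] [Nonempty V] (d D r : ℕ)
    [NeZero d] : PMF (List (List (Trial V d D))) :=
  ((PMF.uniformOfFintype (Trial V d D)).iid (groupSize d)).iid r

variable [Nonempty V] [NeZero d]

theorem groupSize_pos : 0 < groupSize d := by
  have := Nat.pos_of_ne_zero (NeZero.ne d)
  unfold groupSize; positivity

theorem length_of_mem_support_seedDist {r : ℕ} {seed : List (List (Trial V d D))}
    (h : seed ∈ (seedDist V d D r).support) :
    seed.length = r ∧ ∀ l ∈ seed, l.length = groupSize d := by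
  refine ⟨PMF.length_of_mem_support_iid _ _ _ h, ?_⟩
  rw [seedDist] at h
  generalize hμ : (PMF.uniformOfFintype (Trial V d D)).iid (groupSize d) = μ at h
  induction r generalizing seed with
  | zero =>
    simp only [PMF.iid, PMF.support_pure, Set.mem_singleton_iff] at h
    simp [h]
  | succ r ih =>
    simp only [PMF.iid, PMF.mem_support_bind_iff, PMF.mem_support_map_iff] at h
    obtain ⟨l, hl, seed', hs, rfl⟩ := h
    intro l' hl'
    rcases List.mem_cons.1 hl' with rfl | h'
    · rw [← hμ] at hl
      exact PMF.length_of_mem_support_iid _ _ _ hl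
    · exact ih hs l' h'

/-- Sampling rates at which fewer than `1 / (16 * groupSize d)` tuples are expected to survive are
rarely accepted. -/
theorem toOuterMeasure_accepts_le (hO : IsTupleOracle R O) (r : ℕ) (a : Fin d → Fin (D + 1))
    (A : Fin d → Set V)
    (ha : 16 * groupSize d * (tuplesIn R A).ncard ≤ 2 ^ (∑ i, (a i : ℕ))) :
    (seedDist V d D r).toOuterMeasure {seed | Accepts O seed a A} ≤ 2⁻¹ ^ r := by
  classical
  refine le_trans (PMF.toOuterMeasure_mono _ ?_)
    (PMF.toOuterMeasure_iid_majority_le _ (positiveGroups O a A) ?_ r)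
  · rintro seed ⟨hs, hsupp⟩
    have hlen := (length_of_mem_support_seedDist hsupp).1
    change r ≤ _
    rw [← hlen]
    exact hs
  · refine (PMF.toOuterMeasure_iid_exists_mem_le _
      {t | O (trialQuery t a A) = true} _).trans ?_
    rw [toOuterMeasure_uniformOfFintype, ← ENNReal.ofReal_natCast,
      ← ENNReal.ofReal_mul (by positivity),
      show (16⁻¹ : ℝ≥0∞) = ENNReal.ofReal (16⁻¹) by
        rw [ENNReal.ofReal_inv_of_pos (by norm_num)]; simp]
    apply ENNReal.ofReal_le_ofReal
    have hg : (0 : ℝ) < groupSize d := by exact_mod_cast groupSize_pos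
    have h1 := unifProb_trialQuery_le (D := D) hO a A
    have h2 : (16 * groupSize d * (tuplesIn R A).ncard : ℝ) ≤ 2 ^ (∑ i, (a i : ℕ)) := by
      exact_mod_cast ha
    calc _ ≤ (groupSize d : ℝ) * ((tuplesIn R A).ncard / 2 ^ (∑ i, (a i : ℕ))) := by gcongr
      _ ≤ _ := by
        rw [← mul_div_assoc, div_le_iff₀ (by positivity)]
        linarith

/-- Sampling rates at which a trial succeeds with constant probability are rarely rejected. -/
theorem toOuterMeasure_not_accepts_le (r : ℕ) (a : Fin d → Fin (D + 1))
    (A : Fin d → Set V)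
    (ha : 1 / (2 * d) ^ d ≤ unifProb fun t : Trial V d D => O (trialQuery t a A) = true) :
    (seedDist V d D r).toOuterMeasure {seed | ¬ Accepts O seed a A} ≤ 2⁻¹ ^ r := by
  classical
  refine le_trans (PMF.toOuterMeasure_mono _ ?_)
    (PMF.toOuterMeasure_iid_majority_le _ (positiveGroups O a A)ᶜ ?_ r)
  · rintro seed ⟨hs, hsupp⟩
    have hlen := (length_of_mem_support_seedDist hsupp).1
    change r ≤ _
    have hs : ¬ (_ ≤ _) := hs
    have hcount := List.length_eq_countP_add_countP
      (fun l => decide (l ∈ positiveGroups O a A)) (l := seed)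
    simp only [decide_eq_true_eq] at hcount
    simp only [Set.mem_compl_iff]
    omega
  · have hgroup : (positiveGroups O a A)ᶜ =
        {l | ∀ t ∈ l, t ∉ {t : Trial V d D | O (trialQuery t a A) = true}} := by
      ext l
      simp [positiveGroups]
    have hle := unifProb_le_one fun t : Trial V d D => O (trialQuery t a A) = true
    have hcompl : ({t : Trial V d D | O (trialQuery t a A) = true} : Set _)ᶜ =
        {t | ¬ O (trialQuery t a A) = true} := rfl
    rw [hgroup, PMF.toOuterMeasure_iid_forall_notMem, hcompl, toOuterMeasure_uniformOfFintype,
      unifProb_not, ← ENNReal.ofReal_pow (by linarith),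
      show (16⁻¹ : ℝ≥0∞) = ENNReal.ofReal (16⁻¹) by
        rw [ENNReal.ofReal_inv_of_pos (by norm_num)]; simp]
    apply ENNReal.ofReal_le_ofReal
    have hd : (0 : ℝ) < d := by exact_mod_cast Nat.pos_of_ne_zero (NeZero.ne d)
    refine (one_sub_pow_le (unifProb_nonneg _) (unifProb_le_one _) _).trans ?_
    rw [inv_eq_one_div]
    apply one_div_le_one_div_of_le (by norm_num)
    have h16 : (16 : ℝ) = groupSize d * (1 / (2 * d) ^ d) := by
      simp only [groupSize]; push_cast; field_simp
    rw [h16]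
    have : (groupSize d : ℝ) * (1 / (2 * d) ^ d) ≤ groupSize d *
        unifProb fun t : Trial V d D => O (trialQuery t a A) = true := by gcongr
    linarith

/-- The coarse estimate of the number of tuples in `A` is correct up to the factor
`16 * groupSize d * hitLoss D d`, except with exponentially small probability. -/
theorem toOuterMeasure_coarse_le (hO : IsTupleOracle R O)
    (hR : ∀ v, R v → Function.Injective v) (hD : Fintype.card V ≤ 2 ^ D) (r : ℕ)
    (A : Fin d → Set V) :
    (seedDist V d D r).toOuterMeasure {seed | ¬ ((tuplesIn R A).ncard ≤ coarse O seed A ∧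
      coarse O seed A ≤ 16 * groupSize d * hitLoss D d * (tuplesIn R A).ncard)} ≤
    ((D + 1) ^ d + 1 : ℕ) * 2⁻¹ ^ r := by
  classical
  set N := (tuplesIn R A).ncard with hN
  set K := hitLoss D d with hK
  -- the rates that should be rejected
  set F : Finset (Fin d → Fin (D + 1)) :=
    Finset.univ.filter fun a => 16 * groupSize d * N ≤ 2 ^ (∑ i, (a i : ℕ)) with hF
  set μ := (seedDist V d D r).toOuterMeasure with hμ
  have hupper : ∀ seed : List (List (Trial V d D)), (∀ a ∈ F, ¬ Accepts O seed a A) →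
      coarse O seed A ≤ 16 * groupSize d * K * N := by
    intro seed h
    refine Finset.sup_le fun a _ => ?_
    split_ifs with hacc
    · have ha : ¬ 16 * groupSize d * N ≤ 2 ^ (∑ i, (a i : ℕ)) := fun h' =>
        h a (Finset.mem_filter.2 ⟨Finset.mem_univ _, h'⟩) hacc
      calc K * 2 ^ (∑ i, (a i : ℕ)) ≤ K * (16 * groupSize d * N) :=
            Nat.mul_le_mul_left _ (not_le.1 ha).le
        _ = _ := by ring
    · exact Nat.zero_le _
  have hFbad : μ (⋃ a ∈ F, {seed | Accepts O seed a A}) ≤ ((D + 1) ^ d : ℕ) * 2⁻¹ ^ r := by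
    refine (MeasureTheory.measure_biUnion_finset_le F _).trans ?_
    calc _ ≤ ∑ _a ∈ F, (2⁻¹ : ℝ≥0∞) ^ r := Finset.sum_le_sum fun a ha =>
          toOuterMeasure_accepts_le hO r a A (Finset.mem_filter.1 ha).2
      _ ≤ _ := by
        rw [Finset.sum_const, nsmul_eq_mul]
        gcongr
        exact (Finset.card_le_univ F).trans (by simp)
  rcases (tuplesIn R A).eq_empty_or_nonempty with hempty | hne
  · have h0 : N = 0 := by rw [hN, hempty, Set.ncard_empty]
    refine le_trans (MeasureTheory.measure_mono ?_) (hFbad.trans (by gcongr; simp))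
    intro seed hs
    by_contra hcon
    refine hs ⟨by simp [h0], hupper seed fun a ha hacc => hcon ?_⟩
    exact Set.mem_biUnion ha hacc
  · obtain ⟨a₀, h1, h2⟩ := exists_le_unifProb_trialQuery hO hR hD A hne
    refine le_trans (MeasureTheory.measure_mono (t := (⋃ a ∈ F, {seed | Accepts O seed a A}) ∪
      {seed | ¬ Accepts O seed a₀ A}) ?_) ((MeasureTheory.measure_union_le _ _).trans ?_)
    · intro seed hs
      by_contra hcon
      rw [Set.mem_union, not_or] at hcon
      refine hs ⟨?_, hupper seed fun a ha hacc => hcon.1 (Set.mem_biUnion ha hacc)⟩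
      have hacc : Accepts O seed a₀ A := not_not.1 hcon.2
      refine h1.trans ?_
      have := Finset.le_sup (f := fun a : Fin d → Fin (D + 1) =>
        if Accepts O seed a A then hitLoss D d * 2 ^ (∑ i, (a i : ℕ)) else 0) (Finset.mem_univ a₀)
      simp only [hacc, if_true] at this
      exact this
    · push_cast
      rw [add_mul, one_mul]
      refine add_le_add (by exact_mod_cast hFbad) (toOuterMeasure_not_accepts_le r a₀ A h2)

end Coarse

/-! ### The tree of boxes -/

section Tree

variable {V : Type*} {d : ℕ}

open Classical in
/-- Whether a box with at most one tuple contains a tuple, found with one query; no query is needed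
if the sides overlap, since the tuples of interest are injective. -/
noncomputable def leafCount (o : DisjointSets V d → Bool) (A : Fin d → Set V) : ℕ :=
  if ∃ h : Pairwise fun i j => Disjoint (A i) (A j), o ⟨A, h⟩ = true then 1 else 0

theorem leafCount_eq [Finite V] {R : (Fin d → V) → Prop} {O : DisjointSets V d → Bool}
    (hO : IsTupleOracle R O) (hR : ∀ v, R v → Function.Injective v) {A : Fin d → Set V}
    (hA : ∀ i, (A i).Subsingleton) : leafCount O A = (tuplesIn R A).ncard := by
  have hsub : (tuplesIn R A).Subsingleton := fun v hv w hw => funext fun i => hA i (hv.2 i) (hw.2 i)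
  by_cases h : ∃ h : Pairwise fun i j => Disjoint (A i) (A j), O ⟨A, h⟩ = true
  · rw [leafCount, if_pos h]
    obtain ⟨hd, h⟩ := h
    obtain ⟨v, hv, hvA⟩ := (hO _).1 h
    have : tuplesIn R A = {v} := hsub.eq_singleton_of_mem ⟨hv, hvA⟩
    rw [this, Set.ncard_singleton]
  · rw [leafCount, if_neg h, eq_comm, Set.ncard_eq_zero (Set.toFinite _)]
    by_contra hne
    obtain ⟨v, hv⟩ := Set.nonempty_iff_ne_empty.2 hne
    refine h ⟨fun i j hij => Set.disjoint_left.2 fun u hi hj => hij (hR v hv.1 ?_), ?_⟩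
    · rw [hA i (hv.2 i) hi, hA j (hv.2 j) hj]
    · exact (hO _).2 ⟨v, hv.1, hv.2⟩

variable [NeZero d]

/-- The `i`-th side of the box at a node. The vertices have the binary codes `e`; a step
of the path at depth `t` fixes the bit number `t / d` of the coordinate `t % d`. -/
def box (e : V → ℕ) : List Bool → Fin d → Set V
  | [], _ => Set.univ
  | b :: s, i =>
    {u | u ∈ box e s i ∧ (Fin.ofNat d s.length = i → (e u).testBit (s.length / d) = b)}

theorem tuplesIn_box_cons (R : (Fin d → V) → Prop) (e : V → ℕ) (b : Bool) (s : List Bool) :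
    tuplesIn R (box e (b :: s)) = {v ∈ tuplesIn R (box e s) |
      (e (v (Fin.ofNat d s.length))).testBit (s.length / d) = b} := by
  ext v
  simp only [tuplesIn, box]
  constructor
  · rintro ⟨hv, h⟩
    exact ⟨⟨hv, fun i => (h i).1⟩, (h _).2 rfl⟩
  · rintro ⟨⟨hv, h⟩, h'⟩
    refine ⟨hv, fun i => ⟨h i, ?_⟩⟩
    rintro rfl
    exact h'

theorem ncard_tuplesIn_box [Finite V] (R : (Fin d → V) → Prop) (e : V → ℕ) (s : List Bool) :
    (tuplesIn R (box e s)).ncard =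
      (tuplesIn R (box e (true :: s))).ncard + (tuplesIn R (box e (false :: s))).ncard := by
  rw [← Set.ncard_union_eq _ (Set.toFinite _) (Set.toFinite _)]
  · congr 1
    ext v
    rw [tuplesIn_box_cons, tuplesIn_box_cons, Set.mem_union]
    constructor
    · intro hv
      cases h : (e (v (Fin.ofNat d s.length))).testBit (s.length / d)
      · exact Or.inr ⟨hv, h⟩
      · exact Or.inl ⟨hv, h⟩
    · rintro (h | h) <;> exact h.1
  · rw [tuplesIn_box_cons, tuplesIn_box_cons, Set.disjoint_left]
    rintro v ⟨-, h⟩ ⟨-, h'⟩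
    exact absurd (h.symm.trans h') (by simp)

theorem testBit_eq_of_mem_box {e : V → ℕ} {s : List Bool} {i : Fin d} {u u' : V}
    (hu : u ∈ box e s i) (hu' : u' ∈ box e s i) {t : ℕ} (ht : t < s.length)
    (hti : Fin.ofNat d t = i) : (e u).testBit (t / d) = (e u').testBit (t / d) := by
  induction s with
  | nil => simp at ht
  | cons b s ih =>
    rcases Nat.lt_succ_iff_lt_or_eq.1 ht with h | rfl
    · exact ih hu.1 hu'.1 h
    · rw [hu.2 hti, hu'.2 hti]

theorem box_subsingleton {e : V → ℕ} (he : Function.Injective e) {D : ℕ}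
    (hD : ∀ u, e u < 2 ^ D) {s : List Bool} (hs : s.length = d * D) (i : Fin d) :
    (box e s i).Subsingleton := by
  intro u hu u' hu'
  refine he (Nat.eq_of_testBit_eq fun j => ?_)
  by_cases hj : j < D
  · have hd : 0 < d := Nat.pos_of_ne_zero (NeZero.ne d)
    have ht : d * j + i < s.length := by
      rw [hs]
      calc d * j + i < d * j + d := by omega
        _ = d * (j + 1) := by ring
        _ ≤ d * D := Nat.mul_le_mul_left d hj
    have h := testBit_eq_of_mem_box hu hu' ht (by
      ext
      simp [Fin.ofNat, Nat.mod_eq_of_lt i.2])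
    rwa [Nat.mul_add_div hd, Nat.div_eq_of_lt i.2, add_zero] at h
  · have hj' : 2 ^ D ≤ 2 ^ j := Nat.pow_le_pow_right (by norm_num) (not_lt.1 hj)
    rw [Nat.testBit_lt_two_pow ((hD u).trans_le hj'), Nat.testBit_lt_two_pow ((hD u').trans_le hj')]

/-- The estimate for a node: exact at the leaves, at depth `T`, and coarse elsewhere. -/
noncomputable def nodeEst {D : ℕ} (e : V → ℕ) (T : ℕ) (seed : List (List (Trial V d D)))
    (o : DisjointSets V d → Bool) (s : List Bool) : ℝ≥0 :=
  if s.length = T then (leafCount o (box e s) : ℝ≥0) else (coarse o seed (box e s) : ℝ≥0)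

open Classical in
/-- The queries on which the estimate for a node depends. -/
noncomputable def nodeQueries {D : ℕ} (e : V → ℕ) (T : ℕ) (seed : List (List (Trial V d D)))
    (s : List Bool) : List (DisjointSets V d) :=
  if s.length = T then
    if h : Pairwise fun i j : Fin d => Disjoint (box e s i) (box e s j) then [⟨box e s, h⟩]
    else []
  else coarseQueries seed (box e s)

theorem length_nodeQueries_le {D : ℕ} (e : V → ℕ) (T : ℕ) {seed : List (List (Trial V d D))}
    {r g : ℕ} (hr : seed.length = r) (hg : ∀ l ∈ seed, l.length = g) (s : List Bool) :
    (nodeQueries e T seed s).length ≤ (D + 1) ^ d * (r * g) + 1 := by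
  unfold nodeQueries
  by_cases hs : s.length = T
  · rw [if_pos hs]
    by_cases h : Pairwise fun i j : Fin d => Disjoint (box e s i) (box e s j)
    · rw [dif_pos h]; exact Nat.le_add_left 1 _
    · rw [dif_neg h, List.length_nil]; omega
  · rw [if_neg hs, length_coarseQueries hr hg]; omega

theorem nodeEst_congr {D : ℕ} {e : V → ℕ} {T : ℕ} {seed : List (List (Trial V d D))}
    {o o' : DisjointSets V d → Bool} {s : List Bool}
    (h : ∀ q ∈ nodeQueries e T seed s, o q = o' q) :
    nodeEst e T seed o s = nodeEst e T seed o' s := by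
  unfold nodeQueries at h
  unfold nodeEst
  split_ifs with hs
  · rw [if_pos hs] at h
    congr 1
    unfold leafCount
    by_cases hd : Pairwise fun i j : Fin d => Disjoint (box e s i) (box e s j)
    · rw [dif_pos hd] at h
      have := h _ (List.mem_singleton_self _)
      simp only [hd, exists_true_left, this]
    · simp [hd]
  · rw [if_neg hs] at h
    rw [coarse_congr h]

end Tree

/-- A union bound over the inner nodes of the binary tree of depth `T`. -/
theorem PMF.toOuterMeasure_exists_length_lt_le {α : Type*} (μ : PMF α) (p : List Bool → α → Prop)
    (T : ℕ) (δ : ℝ≥0∞) (h : ∀ s, s.length < T → μ.toOuterMeasure {x | p s x} ≤ δ) :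
    μ.toOuterMeasure {x | ∃ s, s.length < T ∧ p s x} ≤ 2 ^ T * δ := by
  induction T with
  | zero => simp
  | succ T ih =>
    have hsub : {x | ∃ s, s.length < T + 1 ∧ p s x} ⊆ {x | ∃ s, s.length < T ∧ p s x} ∪
        ⋃ f ∈ (Finset.univ : Finset (Fin T → Bool)), {x | p (List.ofFn f) x} := by
      rintro x ⟨s, hs, hx⟩
      rcases Nat.lt_succ_iff_lt_or_eq.1 hs with hs | rfl
      · exact Or.inl ⟨s, hs, hx⟩
      · refine Or.inr (Set.mem_biUnion (Finset.mem_univ fun i => s[i]) ?_)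
        change p _ x
        simpa using hx
    calc _ ≤ 2 ^ T * δ + ∑ _f : Fin T → Bool, δ := by
          refine (MeasureTheory.measure_mono hsub).trans
            ((MeasureTheory.measure_union_le _ _).trans (add_le_add ?_ ?_))
          · exact ih fun s hs => h s (by omega)
          · refine (MeasureTheory.measure_biUnion_finset_le _ _).trans ?_
            exact Finset.sum_le_sum fun f _ => h _ (by simp)
      _ = _ := by simp [pow_succ]; ring

/-! ### The estimator -/

section Estimator

open QueryAlg

variable {V : Type*} [Fintype V] {d : ℕ} [NeZero d]

/-- The bound on the factor by which a coarse estimate may be wrong. -/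
def coarseFactor (d D : ℕ) : ℕ := 16 * groupSize d * hitLoss D d

/-- With a seed for which all coarse estimates are correct, the particle estimator is accurate with
constant probability. -/
theorem toOuterMeasure_run_particle_le {R : (Fin d → V) → Prop} {O : DisjointSets V d → Bool}
    (hO : IsTupleOracle R O) (hR : ∀ v, R v → Function.Injective v) {e : V → ℕ}
    (he : Function.Injective e) {D : ℕ} (heD : ∀ u, e u < 2 ^ D) {L : ℕ} {ε : ℝ} (hε : 0 < ε)
    (hε1 : ε < 1) (hL0 : L ≠ 0) (hL : 32 * (coarseFactor d D * (d * D)) / ε ^ 2 ≤ (L : ℝ))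
    {seed : List (List (Trial V d D))}
    (hseed : ∀ s : List Bool, s.length < d * D →
      (tuplesIn R (box e s)).ncard ≤ coarse O seed (box e s) ∧
      coarse O seed (box e s) ≤ coarseFactor d D * (tuplesIn R (box e s)).ncard) :
    ((particle (nodeEst e (d * D) seed) (nodeQueries e (d * D) seed) L (d * D)
      [(1, [])]).run O).toOuterMeasure
      {x | ¬ |({v | R v}.ncard : ℝ) - x| ≤ ε * {v | R v}.ncard} ≤ 16⁻¹ := by
  have hLpos : (0 : ℝ) < L := by exact_mod_cast Nat.pos_of_ne_zero hL0
  set N : List Bool → ℝ≥0 := fun s => ((tuplesIn R (box e s)).ncard : ℝ≥0) with hN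
  have hleaf : ∀ s : List Bool, s.length = d * D → nodeEst e (d * D) seed O s = N s := by
    intro s hs
    rw [nodeEst, if_pos hs, leafCount_eq hO hR (box_subsingleton he heD hs)]
  have hinner : ∀ s : List Bool, s.length ≤ d * D →
      N s ≤ nodeEst e (d * D) seed O s ∧ nodeEst e (d * D) seed O s ≤ coarseFactor d D * N s := by
    intro s hs
    rcases hs.lt_or_eq with hs | hs
    · rw [nodeEst, if_neg hs.ne]
      simp only [hN]
      exact ⟨by exact_mod_cast (hseed s hs).1, by exact_mod_cast (hseed s hs).2⟩
    · rw [hleaf s hs]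
      refine ⟨le_rfl, le_mul_of_one_le_left zero_le ?_⟩
      have h1 : 0 < groupSize d := groupSize_pos
      have h2 : ∀ k, 0 < hitLoss D k := by
        intro k
        induction k with
        | zero => simp [hitLoss]
        | succ k ih => simp only [hitLoss]; positivity
      have h3 : 0 < coarseFactor d D := by have := h2 d; unfold coarseFactor; positivity
      exact_mod_cast h3
  have hroot : total N [(1, [])] = (({v | R v}.ncard : ℕ) : ℝ≥0) := by
    have : tuplesIn R (box e []) = {v | R v} := by ext v; simp [tuplesIn, box]
    simp [total, hN, this]
  obtain ⟨h1, h2⟩ := mean_run_particle (N := N) (est := nodeEst e (d * D) seed)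
    (qs := nodeQueries e (d * D) seed) (O := O) (T := d * D) (b := coarseFactor d D) (L := L)
    (fun s => by simp only [hN]; rw [ncard_tuplesIn_box]; push_cast; rfl) hL0
    (fun o s h => nodeEst_congr h) (fun s hs => (hinner s hs).1) (fun s hs => (hinner s hs).2)
    hleaf (d * D) le_rfl [(1, [])] (by simp)
  rw [hroot] at h1 h2
  have hcheb := toOuterMeasure_chebyshev _ (({v | R v}.ncard : ℕ) : ℝ≥0) (δ := 16⁻¹) hε h1
    (h2.trans ?_) (by norm_num)
  · refine le_trans (le_of_eq ?_) (hcheb.trans (le_of_eq ?_))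
    · simp
    · rw [ENNReal.ofReal_inv_of_pos (by norm_num)]; simp
  · rw [← ENNReal.ofReal_coe_nnreal]
    apply ENNReal.ofReal_le_ofReal
    push_cast
    gcongr
    -- the product of the factors `1 + b / L` is at most `exp (b T / L)`
    set x : ℝ := (coarseFactor d D : ℝ) / L with hx
    have hxT : (d * D : ℕ) * x ≤ ε ^ 2 / 32 := by
      rw [div_le_iff₀ (by positivity)] at hL
      rw [hx, ← mul_div_assoc, div_le_iff₀ hLpos]
      push_cast
      linarith
    have hx0 : 0 ≤ x := by positivity
    have hε2 : ε ^ 2 ≤ 1 := pow_le_one₀ hε.le hε1.le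
    have hexp : (1 + x) ^ (d * D) ≤ Real.exp ((d * D : ℕ) * x) := by
      rw [Real.exp_nat_mul]
      gcongr
      rw [add_comm]
      exact Real.add_one_le_exp x
    have hnn : 0 ≤ (d * D : ℕ) * x := by positivity
    have habs : |(d * D : ℕ) * x| ≤ 1 := by rw [abs_of_nonneg hnn]; linarith
    have := Real.abs_exp_sub_one_le habs
    rw [abs_of_nonneg hnn] at this
    have := le_abs_self (Real.exp ((d * D : ℕ) * x) - 1)
    linarith

variable [DecidableEq V] [Nonempty V]

/-- The estimator for the number of tuples, divided by `c`: the median of `M` independent particle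
estimators that share the seed of the coarse estimates. -/
noncomputable def tupleEstimator (e : V → ℕ) (D r L M : ℕ) (c : ℝ) :
    QueryAlg (DisjointSets V d) ℝ :=
  (draw (seedDist V d D r)).bind fun seed =>
    ((particle (nodeEst e (d * D) seed) (nodeQueries e (d * D) seed) L (d * D)
      [(1, [])]).replicate M).bind fun l => output ((l.map fun x : ℝ≥0 => (x : ℝ)).median / c)

theorem queriesAtMost_tupleEstimator (e : V → ℕ) (D r M : ℕ) {L : ℕ} (hL : L ≠ 0) (c : ℝ) :
    (tupleEstimator e D r L M c : QueryAlg (DisjointSets V d) ℝ).QueriesAtMost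
      (M * ((d * D + 1) * (2 * L * ((D + 1) ^ d * (r * groupSize d) + 1)))) := by
  rw [← zero_add (M * _)]
  refine (queriesAtMost_draw _).bind_of_outputs (outputs_draw _) fun seed hseed => ?_
  obtain ⟨h1, h2⟩ := length_of_mem_support_seedDist hseed
  rw [← add_zero (M * _)]
  refine (queriesAtMost_replicate (queriesAtMost_particle _ _
    (length_nodeQueries_le e (d * D) h1 h2) _ _ ?_) M).bind fun l => ?_
  · simp only [List.length_singleton]; omega
  · simp [QueriesAtMost]

theorem toOuterMeasure_run_tupleEstimator_le {R : (Fin d → V) → Prop}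
    {O : DisjointSets V d → Bool} (hO : IsTupleOracle R O)
    (hR : ∀ v, R v → Function.Injective v) {e : V → ℕ} (he : Function.Injective e) {D : ℕ}
    (heD : ∀ u, e u < 2 ^ D) (hVD : Fintype.card V ≤ 2 ^ D) (r M : ℕ) {L : ℕ} {ε : ℝ}
    (hε : 0 < ε) (hε1 : ε < 1) (hL0 : L ≠ 0)
    (hL : 32 * (coarseFactor d D * (d * D)) / ε ^ 2 ≤ (L : ℝ)) {c : ℝ} (hc : 0 < c) :
    ((tupleEstimator e D r L M c).run O).toOuterMeasure
      {x | ¬ |({v | R v}.ncard : ℝ) / c - x| ≤ ε * ({v | R v}.ncard / c)} ≤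
    2 ^ (d * D) * (((D + 1) ^ d + 1 : ℕ) * 2⁻¹ ^ r) + 2⁻¹ ^ M := by
  classical
  set N : ℝ := (({v | R v}.ncard : ℕ) : ℝ) with hN
  rw [tupleEstimator, run_bind, run_draw]
  refine (PMF.toOuterMeasure_bind_le _ _ _ {seed | ∃ s : List Bool, s.length < d * D ∧
    ¬ ((tuplesIn R (box e s)).ncard ≤ coarse O seed (box e s) ∧
      coarse O seed (box e s) ≤ coarseFactor d D * (tuplesIn R (box e s)).ncard)} (2⁻¹ ^ M)
      fun seed hseed => ?_).trans ?_
  · have hseed' : ∀ s : List Bool, s.length < d * D →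
        (tuplesIn R (box e s)).ncard ≤ coarse O seed (box e s) ∧
        coarse O seed (box e s) ≤ coarseFactor d D * (tuplesIn R (box e s)).ncard := by
      intro s hs
      by_contra hcon
      exact hseed ⟨s, hs, hcon⟩
    have hpart := toOuterMeasure_run_particle_le hO hR he heD hε hε1 hL0 hL hseed'
    rw [run_bind, run_replicate]
    simp only [run]
    refine le_trans ?_ (PMF.toOuterMeasure_iid_majority_le _ _ hpart M)
    change ((PMF.iid _ M).map _).toOuterMeasure _ ≤ _
    rw [PMF.toOuterMeasure_map_apply]
    refine PMF.toOuterMeasure_mono _ ?_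
    rintro l ⟨hl, hsupp⟩
    have hlen := PMF.length_of_mem_support_iid _ _ _ hsupp
    have hmed := List.length_le_of_median_notMem (l.map fun x : ℝ≥0 => (x : ℝ))
      {x | |N - x| ≤ ε * N} (by
        have : {x | |N - x| ≤ ε * N} = Set.Icc (N - ε * N) (N + ε * N) := by
          ext x
          simp only [Set.mem_Icc]
          change |N - x| ≤ ε * N ↔ _
          rw [abs_le]
          constructor <;> rintro ⟨h1, h2⟩ <;> constructor <;> linarith
        rw [this]; exact Set.ordConnected_Icc) (by
        intro hmem
        refine hl ?_
        have hmem : |N - _| ≤ ε * N := hmem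
        rw [← sub_div, abs_div, abs_of_pos hc, ← mul_div_assoc]
        gcongr)
    change M ≤ _
    rw [List.length_map, hlen, List.countP_map] at hmed
    refine hmed.trans_eq ?_
    congr 2
    funext x
    exact decide_eq_decide.2 Iff.rfl
  · gcongr
    exact PMF.toOuterMeasure_exists_length_lt_le _ _ _ _ fun s _ =>
      toOuterMeasure_coarse_le hO hR hVD r (box e s)

end Estimator

/-! ### The number of queries -/

theorem hitLoss_le {D : ℕ} (hD : 1 ≤ D) (k : ℕ) : hitLoss D k ≤ 2 ^ k * (2 * D) ^ k.choose 2 := by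
  induction k with
  | zero => simp [hitLoss]
  | succ k ih =>
    rw [hitLoss, Nat.choose_succ_succ' k 1, Nat.choose_one_right]
    calc 2 * (D + 1) ^ k * hitLoss D k ≤ 2 * (2 * D) ^ k * (2 ^ k * (2 * D) ^ k.choose 2) := by
          gcongr; omega
      _ = _ := by ring

theorem clog_two_le_log {n : ℕ} (hn : 2 ≤ n) : (Nat.clog 2 n : ℝ) ≤ 3 * Real.log n := by
  have h := Nat.pow_pred_clog_lt_self (b := 2) (by norm_num) (show 1 < n by omega)
  have hpos : 0 < Nat.clog 2 n := Nat.clog_pos (by norm_num) hn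
  have h1 : ((Nat.clog 2 n : ℝ) - 1) * Real.log 2 ≤ Real.log n := by
    have h2 : Real.log ((2 : ℝ) ^ (Nat.clog 2 n).pred) ≤ Real.log n :=
      Real.log_le_log (by positivity) (by exact_mod_cast h.le)
    rw [Real.log_pow, Nat.pred_eq_sub_one, Nat.cast_sub hpos] at h2
    simpa using h2
  have h3 : Real.log 2 ≤ Real.log n := Real.log_le_log (by norm_num) (by exact_mod_cast hn)
  have h4 := Real.log_two_gt_d9
  have hD : (1 : ℝ) ≤ Nat.clog 2 n := by exact_mod_cast hpos
  nlinarith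

/-- The constant in the bound on the number of queries, in terms of the binary logarithm. -/
def queryConst (d : ℕ) : ℕ :=
  2 * (2 * d) * (68 * (16 * groupSize d * (2 ^ d * 2 ^ d.choose 2)) * d) *
    (2 ^ d * ((2 * d + 3) * groupSize d) + 1)

theorem queries_le {d D L : ℕ} (hd : 1 ≤ d) (hD : 1 ≤ D) {ε : ℝ} (hε : 0 < ε) (hε1 : ε < 1)
    (hg : 1 ≤ groupSize d)
    (hL : (L : ℝ) ≤ 32 * (coarseFactor d D * (d * D)) / ε ^ 2 + 2) {p : ℕ}
    (hp : d.choose 2 + d + 4 ≤ p) :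
    ((2 * D * ((d * D + 1) * (2 * L * ((D + 1) ^ d * ((2 * d + 3) * D * groupSize d) + 1))) : ℕ) :
      ℝ) ≤ queryConst d * D ^ p / ε ^ 2 := by
  have hd' : (1 : ℝ) ≤ d := by exact_mod_cast hd
  have hD' : (1 : ℝ) ≤ D := by exact_mod_cast hD
  have hg' : (1 : ℝ) ≤ groupSize d := by exact_mod_cast hg
  set g : ℝ := ((groupSize d : ℕ) : ℝ) with hgdef
  set B : ℝ := 16 * g * (2 ^ d * 2 ^ d.choose 2) * D ^ d.choose 2 with hB
  have hB1 : 1 ≤ B := by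
    have h1 : (1 : ℝ) ≤ 2 ^ d := one_le_pow₀ (by norm_num)
    have h2 : (1 : ℝ) ≤ 2 ^ d.choose 2 := one_le_pow₀ (by norm_num)
    have h3 : (1 : ℝ) ≤ D ^ d.choose 2 := one_le_pow₀ hD'
    calc (1 : ℝ) = 1 * 1 * (1 * 1) * 1 := by norm_num
      _ ≤ B := by rw [hB]; gcongr; norm_num
  have hcoarse : (coarseFactor d D : ℝ) ≤ B := by
    have h : (hitLoss D d : ℝ) ≤ 2 ^ d * (2 * D) ^ d.choose 2 := by exact_mod_cast hitLoss_le hD d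
    rw [coarseFactor, hB]
    push_cast
    calc _ ≤ 16 * g * (2 ^ d * (2 * (D : ℝ)) ^ d.choose 2) := by gcongr
      _ = _ := by rw [mul_pow]; ring
  have hε2 : ε ^ 2 ≤ 1 := pow_le_one₀ hε.le hε1.le
  have hBdD : 1 ≤ B * (d * D) := by
    calc (1 : ℝ) = 1 * (1 * 1) := by norm_num
      _ ≤ _ := by gcongr
  have hL2 : (2 * L : ℝ) ≤ 68 * (B * (d * D)) / ε ^ 2 := by
    have h1 : (32 * (coarseFactor d D * (d * D)) / ε ^ 2 : ℝ) ≤ 32 * (B * (d * D)) / ε ^ 2 := by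
      gcongr
    have h2 : (4 : ℝ) ≤ 4 * (B * (d * D)) / ε ^ 2 := by
      rw [le_div_iff₀ (by positivity)]
      nlinarith
    have h3 : 68 * (B * (d * D)) / ε ^ 2 =
        2 * (32 * (B * (d * D)) / ε ^ 2) + 4 * (B * (d * D)) / ε ^ 2 := by ring
    linarith
  have hT : (d * D + 1 : ℝ) ≤ 2 * d * D := by nlinarith
  have hq : ((D + 1) ^ d * ((2 * d + 3) * D * g) + 1 : ℝ) ≤
      (2 ^ d * ((2 * d + 3) * g) + 1) * D ^ (d + 1) := by
    have h1 : ((D : ℝ) + 1) ^ d ≤ (2 * D) ^ d := by gcongr; linarith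
    have h2 : (1 : ℝ) ≤ D ^ (d + 1) := one_le_pow₀ hD'
    calc ((D + 1) ^ d * ((2 * d + 3) * D * g) + 1 : ℝ)
        ≤ (2 * D) ^ d * ((2 * d + 3) * D * g) + D ^ (d + 1) := by gcongr
      _ = _ := by rw [mul_pow]; ring
  calc _ = (2 * D * ((d * D + 1) * (2 * L * ((D + 1) ^ d * ((2 * d + 3) * D * g) + 1))) : ℝ) := by
        push_cast; rfl
    _ ≤ 2 * D * ((2 * d * D) * (68 * (B * (d * D)) / ε ^ 2 *
          ((2 ^ d * ((2 * d + 3) * g) + 1) * D ^ (d + 1)))) := by gcongr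
    _ = queryConst d * D ^ (d.choose 2 + d + 4) / ε ^ 2 := by
        rw [hB, queryConst]; push_cast; ring
    _ ≤ _ := by gcongr

/-! ### Counting tuples with an oracle -/

/-- Approximate counting of injective tuples with an oracle for products of disjoint sets; `d !` is
the number of tuples that enumerate a given set. -/
theorem exists_queryAlg_tuples (d : ℕ) [NeZero d] (p : ℕ) (hp : d.choose 2 + d + 4 ≤ p) :
    ∃ C₀ : ℝ, ∀ C, C₀ ≤ C → ∀ (V : Type*) [Fintype V] [Nonempty V] (ε : ℝ), 0 < ε → ε < 1 →
      ∃ A : QueryAlg (DisjointSets V d) ℝ,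
        A.QueriesAtMost ⌊C * Real.log (Fintype.card V) ^ p / ε ^ 2⌋₊ ∧
        ∀ (R : (Fin d → V) → Prop) (O : DisjointSets V d → Bool), IsTupleOracle R O →
          (∀ v, R v → Function.Injective v) →
          1 - 1 / (Fintype.card V : ℝ) ≤
            A.approxProb O ε (({v | R v}.ncard : ℝ) / d.factorial) := by
  classical
  refine ⟨queryConst d * 3 ^ p, fun C hC V _ _ ε hε hε1 => ?_⟩
  set n := Fintype.card V with hn
  have hn0 : 0 < n := Fintype.card_pos
  rcases Nat.lt_or_ge n 2 with hn2 | hn2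
  · -- with a single vertex nothing is claimed about the output
    have h1 : n = 1 := by omega
    refine ⟨.output 0, by simp [QueryAlg.QueriesAtMost], fun R O _ _ => ?_⟩
    rw [h1]
    simp [QueryAlg.approxProb]
  set D := Nat.clog 2 n with hD
  have hnD : n ≤ 2 ^ D := Nat.le_pow_clog (by norm_num) n
  have hD1 : 1 ≤ D := Nat.clog_pos (by norm_num) hn2
  have hd1 : 1 ≤ d := Nat.pos_of_ne_zero (NeZero.ne d)
  set x : ℝ := 32 * (coarseFactor d D * (d * D)) / ε ^ 2 with hx
  have hx0 : 0 ≤ x := by positivity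
  set e : V → ℕ := fun u => (Fintype.equivFin V u : ℕ) with he
  have hinj : Function.Injective e :=
    Fin.val_injective.comp (Fintype.equivFin V).injective
  have heD : ∀ u, e u < 2 ^ D := fun u => (Fintype.equivFin V u).2.trans_le hnD
  refine ⟨tupleEstimator e D ((2 * d + 3) * D) (⌈x⌉₊ + 1) (2 * D) d.factorial, ?_, ?_⟩
  · refine (queriesAtMost_tupleEstimator e D _ _ (Nat.succ_ne_zero _) _).mono (Nat.le_floor ?_)
    refine (queries_le (ε := ε) hd1 hD1 hε hε1 groupSize_pos ?_ hp).trans ?_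
    · push_cast
      have := (Nat.ceil_lt_add_one hx0).le
      linarith
    · have hlog := clog_two_le_log hn2
      have hlog0 : 0 ≤ Real.log n := Real.log_natCast_nonneg n
      calc (queryConst d * D ^ p / ε ^ 2 : ℝ) ≤ queryConst d * (3 * Real.log n) ^ p / ε ^ 2 := by
            gcongr
        _ = queryConst d * 3 ^ p * Real.log n ^ p / ε ^ 2 := by rw [mul_pow]; ring
        _ ≤ _ := by gcongr
  · intro R O hO hR
    have hfail := toOuterMeasure_run_tupleEstimator_le hO hR hinj heD hnD ((2 * d + 3) * D) (2 * D)
      hε hε1 (Nat.succ_ne_zero ⌈x⌉₊) (by push_cast; linarith [Nat.le_ceil x])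
      (c := d.factorial) (by positivity)
    have hbound : (2 : ℝ≥0∞) ^ (d * D) * (((D + 1) ^ d + 1 : ℕ) * 2⁻¹ ^ ((2 * d + 3) * D)) +
        2⁻¹ ^ (2 * D) ≤ ENNReal.ofReal (1 / n) := by
      have h1 : (2 : ℝ) ^ (d * D) * (((D + 1) ^ d + 1 : ℕ) * 2⁻¹ ^ ((2 * d + 3) * D)) +
          2⁻¹ ^ (2 * D) ≤ 1 / n := by
        have hD2 : ((D : ℝ) + 1) ^ d ≤ 2 ^ (d * D) := by
          rw [mul_comm, pow_mul]
          gcongr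
          exact_mod_cast Nat.lt_two_pow_self
        have h1' : (1 : ℝ) ≤ 2 ^ (d * D) := one_le_pow₀ (by norm_num)
        have h2D : (2 : ℝ) ≤ 2 ^ D := le_self_pow₀ (by norm_num) (by omega)
        have hcount : (((D + 1) ^ d + 1 : ℕ) : ℝ) ≤ 2 ^ D * 2 ^ (d * D) := by
          push_cast
          nlinarith
        have hnD' : (n : ℝ) ≤ 2 ^ D := by exact_mod_cast hnD
        calc _ ≤ (2 : ℝ) ^ (d * D) * ((2 ^ D * 2 ^ (d * D)) * 2⁻¹ ^ ((2 * d + 3) * D)) +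
              2⁻¹ ^ (2 * D) := by gcongr
          _ = 2 * 2⁻¹ ^ (2 * D) := by
            have : (2⁻¹ : ℝ) ^ ((2 * d + 3) * D) =
                (2 ^ (d * D))⁻¹ * (2 ^ (d * D))⁻¹ * (2 ^ D)⁻¹ * 2⁻¹ ^ (2 * D) := by
              simp only [← inv_pow, ← pow_add]
              congr 1; ring
            rw [this]
            field_simp
            norm_num
          _ ≤ 2 ^ D * 2⁻¹ ^ (2 * D) := by gcongr
          _ = 1 / 2 ^ D := by
            rw [two_mul, pow_add, inv_pow]
            field_simp
          _ ≤ 1 / n := by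
            have : (0 : ℝ) < n := by exact_mod_cast hn0
            gcongr
      refine le_trans (le_of_eq ?_) (ENNReal.ofReal_le_ofReal h1)
      rw [ENNReal.ofReal_add (by positivity) (by positivity), ENNReal.ofReal_mul (by positivity),
        ENNReal.ofReal_mul (by positivity), ENNReal.ofReal_pow (by norm_num),
        ENNReal.ofReal_pow (by norm_num), ENNReal.ofReal_pow (by norm_num),
        ENNReal.ofReal_natCast, ENNReal.ofReal_inv_of_pos (by norm_num)]
      simp
    have hfail := hfail.trans hbound
    rw [QueryAlg.approxProb]
    set μ := QueryAlg.run O (tupleEstimator e D ((2 * d + 3) * D) (⌈x⌉₊ + 1) (2 * D)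
      d.factorial) with hμ
    have hadd := μ.toOuterMeasure_add_compl
      {y | |({v | R v}.ncard : ℝ) / d.factorial - y| ≤ ε * ({v | R v}.ncard / d.factorial)}
    have hne : ∀ s, μ.toOuterMeasure s ≠ ⊤ := fun s =>
      ((μ.toOuterMeasure_le_one s).trans_lt ENNReal.one_lt_top).ne
    have hreal := congrArg ENNReal.toReal hadd
    rw [ENNReal.toReal_add (hne _) (hne _), ENNReal.toReal_one] at hreal
    have hcompl := ENNReal.toReal_le_of_le_ofReal (by positivity) hfail
    change (μ.toOuterMeasure ({y | |({v | R v}.ncard : ℝ) / d.factorial - y| ≤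
      ε * ({v | R v}.ncard / d.factorial)} : Set ℝ)ᶜ).toReal ≤ 1 / n at hcompl
    linarith

/-! ### The three oracles -/

section Oracles

variable {V : Type*}

/-- A set of `d` elements has `d !` enumerations. -/
theorem ncard_injective_range_mem [Finite V] {d : ℕ} (E : Set (Set V)) (hE : ∀ e ∈ E, e.ncard = d) :
    {v : Fin d → V | Function.Injective v ∧ Set.range v ∈ E}.ncard = E.ncard * d.factorial := by
  classical
  have := Fintype.ofFinite V
  set α := {v : Fin d → V // Function.Injective v ∧ Set.range v ∈ E}
  let f : α → E := fun v => ⟨Set.range v.1, v.2.2⟩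
  have hfiber : ∀ e : E, Nat.card {v : α // f v = e} = d.factorial := by
    rintro ⟨e, he⟩
    have hcard : Fintype.card e = d := by rw [← hE e he, Set.ncard_eq_toFinset_card']; simp
    let g : {v : α // f v = ⟨e, he⟩} ≃ (Fin d ↪ e) :=
      { toFun := fun v => ⟨fun i => ⟨v.1.1 i, by
            have h := congrArg Subtype.val v.2
            change Set.range v.1.1 = e at h
            exact h.subset (Set.mem_range_self i)⟩,
          fun i j hij => v.1.2.1 (congrArg Subtype.val hij)⟩
        invFun := fun h =>
          have hr : Set.range (fun i => (h i : V)) = e := by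
            refine Set.eq_of_subset_of_ncard_le ?_ ?_ (Set.toFinite _)
            · rintro _ ⟨i, rfl⟩; exact (h i).2
            · have hinj : Function.Injective fun i => (h i : V) :=
                Subtype.val_injective.comp h.injective
              rw [hE e he, Set.ncard_range_of_injective hinj]
              simp
          ⟨⟨fun i => (h i : V), Subtype.val_injective.comp h.injective, by rw [hr]; exact he⟩,
            Subtype.ext hr⟩
        left_inv := fun v => rfl
        right_inv := fun h => rfl }
    rw [Nat.card_congr g, Nat.card_eq_fintype_card, Fintype.card_embedding_eq, hcard,
      Fintype.card_fin, Nat.descFactorial_self]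
  have h1 := Nat.card_congr (Equiv.sigmaFiberEquiv f)
  rw [Nat.card_sigma] at h1
  simp only [hfiber, Finset.sum_const, Finset.card_univ, smul_eq_mul] at h1
  rw [← Nat.card_coe_set_eq, ← Nat.card_coe_set_eq E, Nat.card_eq_fintype_card (α := E)]
  exact h1.symm

theorem isTupleOracle_cidOracle {d : ℕ} [Finite V] (H : Hypergraph V) (hH : H.IsUniformOnUniv d) :
    IsTupleOracle (fun v => Function.Injective v ∧ Set.range v ∈ H.edgeSet)
      (cidOracle (d := d) H) := by
  intro A
  simp only [cidOracle, decide_eq_true_eq]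
  constructor
  · rintro ⟨e, he, h⟩
    choose v hv using fun i => Set.ncard_eq_one.1 (h i)
    have hmem : ∀ i, v i ∈ e ∩ A.1 i := fun i => by rw [hv i]; rfl
    have hinj : Function.Injective v := fun i j hij => by
      by_contra hne
      exact Set.disjoint_left.1 (A.2 hne) (hmem i).2 (hij ▸ (hmem j).2)
    refine ⟨v, ⟨hinj, ?_⟩, fun i => (hmem i).2⟩
    have : Set.range v = e := by
      refine Set.eq_of_subset_of_ncard_le ?_ ?_ (Set.toFinite _)
      · rintro _ ⟨i, rfl⟩; exact (hmem i).1
      · rw [hH.ncard_eq e he, Set.ncard_range_of_injective hinj]; simp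
    rwa [this]
  · rintro ⟨v, ⟨hinj, hv⟩, hA⟩
    refine ⟨_, hv, fun i => Set.ncard_eq_one.2 ⟨v i, ?_⟩⟩
    ext u
    constructor
    · rintro ⟨⟨j, rfl⟩, hj⟩
      by_contra hne
      have hij : i ≠ j := fun h => hne (by rw [h]; rfl)
      exact Set.disjoint_left.1 (A.2 hij) hj (hA j)
    · rintro rfl
      exact ⟨Set.mem_range_self i, hA i⟩

theorem isTupleOracle_bisOracle (G : SimpleGraph V) :
    IsTupleOracle (fun v => G.Adj (v 0) (v 1)) (bisOracle G) := by
  intro A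
  simp only [bisOracle, decide_eq_true_eq]
  constructor
  · rintro ⟨u, hu, v, hv, h⟩
    exact ⟨![u, v], h, by simp [Fin.forall_fin_two, hu, hv]⟩
  · rintro ⟨v, h, hA⟩
    exact ⟨_, hA 0, _, hA 1, h⟩

theorem isTupleOracle_tisOracle (G : SimpleGraph V) :
    IsTupleOracle (fun v => G.Adj (v 0) (v 1) ∧ G.Adj (v 1) (v 2) ∧ G.Adj (v 0) (v 2))
      (tisOracle G) := by
  intro A
  simp only [tisOracle, decide_eq_true_eq]
  constructor
  · rintro ⟨u, hu, v, hv, w, hw, h⟩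
    exact ⟨![u, v, w], h, by simp [Fin.forall_fin_succ, hu, hv, hw]⟩
  · rintro ⟨v, h, hA⟩
    exact ⟨_, hA 0, _, hA 1, _, hA 2, h⟩

theorem injective_of_adj {G : SimpleGraph V} {v : Fin 2 → V} (h : G.Adj (v 0) (v 1)) :
    Function.Injective v := by
  intro i j hij
  fin_cases i <;> fin_cases j <;> simp_all

theorem injective_of_triangle {G : SimpleGraph V} {v : Fin 3 → V}
    (h : G.Adj (v 0) (v 1) ∧ G.Adj (v 1) (v 2) ∧ G.Adj (v 0) (v 2)) : Function.Injective v := by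
  obtain ⟨h1, h2, h3⟩ := h
  intro i j hij
  have := h1.ne; have := h2.ne; have := h3.ne
  fin_cases i <;> fin_cases j <;> simp_all

theorem ncard_adj [Finite V] (G : SimpleGraph V) :
    {v : Fin 2 → V | G.Adj (v 0) (v 1)}.ncard = G.edgeSet.ncard * Nat.factorial 2 := by
  classical
  have := Fintype.ofFinite V
  let g : {v : Fin 2 → V // G.Adj (v 0) (v 1)} ≃ G.Dart :=
    { toFun := fun v => ⟨(v.1 0, v.1 1), v.2⟩
      invFun := fun x => ⟨![x.fst, x.snd], x.adj⟩
      left_inv := fun v => Subtype.ext (by funext i; fin_cases i <;> rfl)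
      right_inv := fun x => rfl }
  rw [← Nat.card_coe_set_eq]
  refine (Nat.card_congr g).trans ?_
  rw [Nat.card_eq_fintype_card, G.dart_card_eq_twice_card_edges, ← SimpleGraph.coe_edgeFinset,
    Set.ncard_coe_finset, mul_comm]
  rfl

theorem ncard_triangle [Finite V] (G : SimpleGraph V) :
    {v : Fin 3 → V | G.Adj (v 0) (v 1) ∧ G.Adj (v 1) (v 2) ∧ G.Adj (v 0) (v 2)}.ncard =
      (G.cliqueSet 3).ncard * Nat.factorial 3 := by
  classical
  have himage : ((fun s : Finset V => (s : Set V)) '' G.cliqueSet 3).ncard =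
      (G.cliqueSet 3).ncard := Set.ncard_image_of_injective _ Finset.coe_injective
  rw [← himage, ← ncard_injective_range_mem]
  · congr 1
    ext v
    constructor
    · intro h
      refine ⟨injective_of_triangle h, {v 0, v 1, v 2}, ?_, ?_⟩
      · exact SimpleGraph.is3Clique_iff.2 ⟨_, _, _, h.1, h.2.2, h.2.1, rfl⟩
      · ext u; simp [Fin.exists_fin_succ, eq_comm]
    · rintro ⟨hinj, s, hs, hv⟩
      have hmem : ∀ i, v i ∈ s := fun i => by
        have : v i ∈ (s : Set V) := by
          change (s : Set V) = _ at hv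
          rw [hv]; exact Set.mem_range_self i
        simpa using this
      have hadj : ∀ i j, i ≠ j → G.Adj (v i) (v j) := fun i j hij =>
        hs.isClique (by simpa using hmem i) (by simpa using hmem j) (hinj.ne hij)
      exact ⟨hadj _ _ (by decide), hadj _ _ (by decide), hadj _ _ (by decide)⟩
  · rintro _ ⟨s, hs, rfl⟩
    change (s : Set V).ncard = 3
    rw [Set.ncard_coe_finset]
    exact hs.card_eq

end Oracles

theorem mainTheorem3 :
    ∃ c : ℝ, 0 < c ∧ ∃ C : ℝ, 0 < C ∧
      ∀ (V : Type*) [Fintype V] [Nonempty V] (ε : ℝ), 0 < ε → ε < 1 →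
        -- (a) edge estimation in graphs with BIS queries
        (∃ A : QueryAlg (DisjointSets V 2) ℝ,
          A.QueriesAtMost ⌊C * Real.log (Fintype.card V) ^ 11 / ε ^ 2⌋₊ ∧
          ∀ G : SimpleGraph V,
            1 - 1 / (Fintype.card V : ℝ) ^ (c * 2) ≤
              A.approxProb (bisOracle G) ε (G.edgeSet.ncard : ℝ)) ∧
        -- (b) hyperedge estimation in 3-uniform hypergraphs with CID queries
        (∃ A : QueryAlg (DisjointSets V 3) ℝ,
          A.QueriesAtMost ⌊C * Real.log (Fintype.card V) ^ 14 / ε ^ 2⌋₊ ∧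
          ∀ H : Hypergraph V, H.IsUniformOnUniv 3 →
            1 - 1 / (Fintype.card V : ℝ) ^ (c * 3) ≤
              A.approxProb (cidOracle H) ε (H.edgeSet.ncard : ℝ)) ∧
        -- in particular, triangle estimation in graphs with TIS queries
        (∃ A : QueryAlg (DisjointSets V 3) ℝ,
          A.QueriesAtMost ⌊C * Real.log (Fintype.card V) ^ 14 / ε ^ 2⌋₊ ∧
          ∀ G : SimpleGraph V,
            1 - 1 / (Fintype.card V : ℝ) ^ (c * 3) ≤
              A.approxProb (tisOracle G) ε ((G.cliqueSet 3).ncard : ℝ)) := by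
  obtain ⟨C₂, h₂⟩ := exists_queryAlg_tuples 2 11 (by decide)
  obtain ⟨C₃, h₃⟩ := exists_queryAlg_tuples 3 14 (by decide)
  refine ⟨1 / 3, by norm_num, max 1 (max C₂ C₃), by positivity, ?_⟩
  intro V _ _ ε hε hε1
  -- the algorithms fail with probability at most `1 / n`
  have hprob : ∀ k : ℝ, k ≤ 3 → 1 - 1 / (Fintype.card V : ℝ) ^ (1 / 3 * k) ≤
      1 - 1 / (Fintype.card V : ℝ) := by
    intro k hk
    have hn : (1 : ℝ) ≤ Fintype.card V := by exact_mod_cast Fintype.card_pos (α := V)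
    have hpow : (Fintype.card V : ℝ) ^ (1 / 3 * k) ≤ Fintype.card V :=
      (Real.rpow_le_rpow_of_exponent_le hn (by linarith)).trans_eq (Real.rpow_one _)
    gcongr
  obtain ⟨A₂, hA₂, hA₂'⟩ := h₂ _ ((le_max_left C₂ C₃).trans (le_max_right _ _)) V ε hε hε1
  obtain ⟨A₃, hA₃, hA₃'⟩ := h₃ _ ((le_max_right C₂ C₃).trans (le_max_right 1 _)) V ε hε hε1
  refine ⟨⟨A₂, hA₂, fun G => ?_⟩, ⟨A₃, hA₃, fun H hH => ?_⟩, A₃, hA₃, fun G => ?_⟩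
  · have h := hA₂' _ _ (isTupleOracle_bisOracle G) fun v => injective_of_adj
    rw [ncard_adj, Nat.cast_mul, mul_div_cancel_right₀ _ (by positivity)] at h
    exact (hprob 2 (by norm_num)).trans h
  · have h := hA₃' _ _ (isTupleOracle_cidOracle H hH) fun v hv => hv.1
    rw [ncard_injective_range_mem _ hH.ncard_eq, Nat.cast_mul,
      mul_div_cancel_right₀ _ (by positivity)] at h
    exact (hprob 3 le_rfl).trans h
  · have h := hA₃' _ _ (isTupleOracle_tisOracle G) fun v => injective_of_triangle
    rw [ncard_triangle, Nat.cast_mul, mul_div_cancel_right₀ _ (by positivity)] at h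
    exact (hprob 3 le_rfl).trans h
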